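/- Let $n\ge 1$, let $A\in\mathbb C^{n\times n}$ be anti-Hermitian ($A^*=-A$), let $C\in\mathbb C^{n\times n}$ be Hermitian positive semi-definite, and for $\epsilon\in\mathbb R$ put $B_\epsilon:=\epsilon A+C$. A matrix is called hypocoercive if all its eigenvalues have positive real part. For a matrix $B$ with Hermitian part $B_H=\frac12(B+B^*)$ and anti-Hermitian part $B_A=\frac12(B-B^*)$, the hypocoercivity index $m_{HC}(B)$ is the smallest $m\in\mathbb N_0$ such that $\sum_{j=0}^m B_A^jB_H(B_A^*)^j$ is positive definite ($m_{HC}(B)=\infty$ if there is none). For $m\in\mathbb N_0$ put $\widetilde{\widetilde T}_{m-1}(B):=\sum_{j=0}^{m-1}(B^*)^jB_HB^j$, which is $0$ for $m=0$. Suppose that $B_{\epsilon_0}$ is hypocoercive for some real $\epsilon_0\neq0$. Then there are $m\in\mathbb N_0$ and $\mu>0$, both independent of $\epsilon$, such that for every real $\epsilon\ne0$: $m_{HC}(B_\epsilon)=m$, $$\mu=\min\bigl\{\langle x_0,(A^*)^mCA^mx_0\rangle : x_0\in\ker\widetilde{\widetilde T}_{m-1}(B_\epsilon),\ \|x_0\|_2=1\bigr\}$$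 (the minimum being attained), and, in the spectral norm, $$\|e^{-B_\epsilon t}\|_2=1-c_\epsilon t^{2m+1}+\mathcal O(t^{2m+2})\quad(t\to0^+),\qquad c_\epsilon=\epsilon^{2m}\,\frac{1}{(2m+1)!\binom{2m}{m}}\,\mu .$$ Moreover $a=2m+1$, $c=c_\epsilon$ is the only pair of real numbers $a,c>0$ for which $\|e^{-B_\epsilon t}\|_2=1-ct^a+\mathcal O(t^{a+1})$ as $t\to0^+$. -/

import Mathlib

open scoped ComplexOrder

namespace ShortTimeDecay

/-- The Hermitian part `B_H = (B + B*) / 2`. -/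
noncomputable def hermPart {n : ℕ} (B : Matrix (Fin n) (Fin n) ℂ) : Matrix (Fin n) (Fin n) ℂ :=
  (1 / 2 : ℂ) • (B + B.conjTranspose)

/-- The anti-Hermitian part `B_A = (B - B*) / 2`. -/
noncomputable def antiHermPart {n : ℕ} (B : Matrix (Fin n) (Fin n) ℂ) :
    Matrix (Fin n) (Fin n) ℂ :=
  (1 / 2 : ℂ) • (B - B.conjTranspose)

/-- `B` is hypocoercive: its spectrum lies in the open right half plane. -/
def IsHypocoercive {n : ℕ} (B : Matrix (Fin n) (Fin n) ℂ) : Prop :=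
  ∀ z ∈ spectrum ℂ B, 0 < z.re

/-- `T_m = ∑_{j=0}^m (B_A)^j B_H (B_A*)^j`. -/
noncomputable def T {n : ℕ} (B : Matrix (Fin n) (Fin n) ℂ) (m : ℕ) : Matrix (Fin n) (Fin n) ℂ :=
  ∑ j ∈ Finset.range (m + 1),
    antiHermPart B ^ j * hermPart B * (antiHermPart B).conjTranspose ^ j

/-- The hypocoercivity index: the smallest `m` with `T_m` positive definite, `⊤` if there is
none. -/
noncomputable def hcIndex {n : ℕ} (B : Matrix (Fin n) (Fin n) ℂ) : ℕ∞ :=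
  sInf {k : ℕ∞ | ∃ m : ℕ, k = (m : ℕ∞) ∧ (T B m).PosDef}

/-- The sum `∑_{j=0}^{m-1} (B*)^j B_H B^j` of the first `m` terms; it is `0` for `m = 0`. -/
noncomputable def TTildePred {n : ℕ} (B : Matrix (Fin n) (Fin n) ℂ) (m : ℕ) :
    Matrix (Fin n) (Fin n) ℂ :=
  ∑ j ∈ Finset.range m, B.conjTranspose ^ j * hermPart B * B ^ j

/-- The propagator norm: the spectral norm of `exp (-B t)`, as an operator on Euclidean space. -/
noncomputable def propagatorNorm {n : ℕ} (B : Matrix (Fin n) (Fin n) ℂ) (t : ℝ) : ℝ :=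
  ‖Matrix.toEuclideanCLM (n := Fin n) (𝕜 := ℂ) (NormedSpace.exp (-((t : ℂ) • B)))‖

/-- `‖exp (-B t)‖ = 1 - c t ^ a + O (t ^ (a + 1))` for `t` in some interval `[0, δ)`, `δ > 0`. -/
def HasShortTimeDecay {n : ℕ} (B : Matrix (Fin n) (Fin n) ℂ) (a c : ℝ) : Prop :=
  ∃ δ : ℝ, 0 < δ ∧ ∃ M : ℝ, ∀ t : ℝ, 0 ≤ t → t < δ →
    |propagatorNorm B t - (1 - c * t ^ a)| ≤ M * t ^ (a + 1)

/-- The values `⟨x, (A*)^m C A^m x⟩` (real for Hermitian `C`) at the Euclidean unit vectors `x` in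
the kernel of `∑_{j=0}^{m-1} (B*)^j B_H B^j`. -/
def kernelValues {n : ℕ} (B A C : Matrix (Fin n) (Fin n) ℂ) (m : ℕ) : Set ℝ :=
  {r | ∃ x : EuclideanSpace ℂ (Fin n),
    x ∈ LinearMap.ker (Matrix.toEuclideanLin (TTildePred B m)) ∧ ‖x‖ = 1 ∧
    r = (inner ℂ x (Matrix.toEuclideanLin (A.conjTranspose ^ m * C * A ^ m) x)).re}

/-- The coefficient `ε^{2m} * ((2m+1)! * binom(2m, m))⁻¹ * μ`. -/
noncomputable def decayCoeff (ε : ℝ) (m : ℕ) (μ : ℝ) : ℝ :=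
  ε ^ (2 * m) * (1 / (((2 * m + 1).factorial : ℝ) * ((2 * m).choose m : ℝ)) * μ)

end ShortTimeDecay

namespace ShortTimeDecay

/-! Factor `C = D* D`. Since `A` is anti-Hermitian, the energy identity reads `‖exp(-Bt) x‖² = ‖x‖²
- 2 ∫₀ᵗ ‖D exp(-Bs) x‖² ds`, so expanding the propagator norm amounts to minimising the dissipation
integral over unit vectors `x`.

To make that integral as small as possible, `x` must lie within `O(t)` of the joint kernel of `D
B^j`, `j < m`. Near a kernel vector `x₀` the integrand is, up to `O(t^(m+1))`, a vector polynomial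
in `s` with leading coefficient `(-1)^m / m! · D B^m x₀`. Corrections of `x₀` by the vectors
`t^(m-k) B^(m-k) x₀` adjust its lower coefficients at will. The least `L²` norm on `[0, t]` with
prescribed leading coefficient belongs to the monic shifted Legendre polynomial, of squared norm
`t^(2m+1) / ((2m+1) binom(2m,m)²)`. Multiplied by `1 / m!²` this is the stated factor
(`decayFactor_eq`). The lower bound, uniform on the sphere, is `exists_dissipation_uniform_lower`;
the matching test vectors are in `exists_dissipation_upper`; `exists_norm_semigroup_expansion` takes
square roots.

Independence of `ε`: as long as `D` annihilates the iterates, `B^j x = ε^j A^j x`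
(`pow_apply_eq_of_dissipation_zero`). Hence all joint kernels are those of `D A^j`, and `ε` enters
only through `ε^(2m)`. Hypocoercivity at one `ε₀` makes these kernels eventually trivial, which
fixes `m` and gives `μ > 0`. -/

/-! ### Shifted Legendre polynomials: moments and rescaling to `[0, t]` -/

open Finset in
/-- The coefficients of the monic shifted Legendre polynomial on `[0, 1]`, characterised by
orthogonality to lower powers, with the value of its squared norm. -/
theorem exists_legendre_coeff (m : ℕ) : ∃ l : ℕ → ℝ, l m = 1 ∧
    ∀ i ≤ m, ∑ k ∈ range (m + 1), l k / ((k : ℝ) + i + 1) =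
      if i = m then 1 / ((2 * m + 1) * ((2 * m).choose m : ℝ) ^ 2) else 0 := by
  classical
  set v : ℕ → ℝ := fun k => -((k : ℝ) + 1) with hv
  have hvinj : Set.InjOn v (range (m + 1) : Finset ℕ) := by
    intro a _ b _ h
    simp only [hv, neg_inj, add_left_inj, Nat.cast_inj] at h
    exact h
  set P : Polynomial ℝ := Lagrange.nodal (range m) (fun r : ℕ => (r : ℝ)) with hP
  have hdeg : P.degree < (#(range (m + 1)) : ℕ) := by
    rw [hP, Lagrange.degree_nodal, card_range, card_range]
    exact_mod_cast Nat.lt_succ_self m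
  have key : ∀ i : ℕ, ∑ k ∈ range (m + 1),
      (Lagrange.nodalWeight (range (m + 1)) v k * P.eval (v k)) / ((k : ℝ) + i + 1) =
      P.eval (i : ℝ) / ∏ k ∈ range (m + 1), ((k : ℝ) + i + 1) := by
    intro i
    have hne : ∀ k ∈ range (m + 1), (i : ℝ) ≠ v k := by
      intro k _ h
      have h0 : (i : ℝ) + k + 1 = 0 := by rw [h]; simp only [hv]; ring
      have h1 : (0 : ℝ) < (i : ℝ) + k + 1 := by positivity
      exact h1.ne' h0
    have h1 := Lagrange.eval_interpolate_not_at_node (fun k => P.eval (v k)) hne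
    rw [← Lagrange.eq_interpolate hvinj hdeg, Lagrange.eval_nodal (s := range (m + 1))] at h1
    have h2 : ∏ k ∈ range (m + 1), ((i : ℝ) - v k) = ∏ k ∈ range (m + 1), ((k : ℝ) + i + 1) :=
      prod_congr rfl fun k _ => by simp only [hv]; ring
    rw [h2] at h1
    have h3 : ∏ k ∈ range (m + 1), ((k : ℝ) + i + 1) ≠ 0 :=
      prod_ne_zero_iff.2 fun k _ => by positivity
    rw [h1, mul_div_cancel_left₀ _ h3]
    refine sum_congr rfl fun k _ => ?_
    have : (i : ℝ) - v k = (k : ℝ) + i + 1 := by simp only [hv]; ring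
    rw [this]; ring
  have hsub : ∏ r ∈ range m, ((m : ℝ) - r) = (m.factorial : ℝ) := by
    rw [← prod_range_add_one_eq_factorial, ← prod_range_reflect]
    push_cast
    refine prod_congr rfl fun r hr => ?_
    have hr' := mem_range.1 hr
    rw [Nat.sub_sub, Nat.cast_sub (by omega)]
    push_cast; ring
  have hasc : ∀ p : ℕ, (∏ r ∈ range p, ((r : ℝ) + m + 1)) * m.factorial = ((m + p).factorial : ℝ) := by
    intro p
    induction p with
    | zero => simp
    | succ p ih =>
      rw [prod_range_succ, mul_right_comm, ih, ← add_assoc, Nat.factorial_succ]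
      push_cast; ring
  have hcen : ((2 * m).choose m : ℝ) * (m.factorial : ℝ) ^ 2 = ((2 * m).factorial : ℝ) := by
    have h := Nat.choose_mul_factorial_mul_factorial (show m ≤ 2 * m by omega)
    rw [show 2 * m - m = m by omega] at h
    rw [← h]; push_cast; ring
  have hm0 : (m.factorial : ℝ) ≠ 0 := by positivity
  have hc0 : ((2 * m).choose m : ℝ) ≠ 0 := by
    exact_mod_cast (Nat.choose_pos (show m ≤ 2 * m by omega)).ne'
  have hlead : Lagrange.nodalWeight (range (m + 1)) v m * P.eval (v m) =
      ((2 * m).choose m : ℝ) := by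
    have he : (range (m + 1)).erase m = range m := by
      ext; simp only [mem_erase, mem_range]; omega
    have hneg : ∏ _r ∈ range m, (-1 : ℝ) = (-1) ^ m := by rw [prod_const, card_range]
    have h1 : ∏ r ∈ range m, (v m - r) = (-1) ^ m * ∏ r ∈ range m, ((r : ℝ) + m + 1) := by
      rw [← hneg, ← prod_mul_distrib]
      exact prod_congr rfl fun r _ => by simp only [hv]; ring
    have h2 : ∏ r ∈ range m, (v m - v r) = (-1) ^ m * ∏ r ∈ range m, ((m : ℝ) - r) := by
      rw [← hneg, ← prod_mul_distrib]
      exact prod_congr rfl fun r _ => by simp only [hv]; ring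
    have h3 := hasc m
    rw [← two_mul, ← hcen] at h3
    have h4 : ∏ r ∈ range m, ((r : ℝ) + m + 1) = ((2 * m).choose m : ℝ) * m.factorial := by
      apply mul_right_cancel₀ hm0
      rw [h3]; ring
    rw [Lagrange.nodalWeight, he, prod_inv_distrib, h2, hP, Lagrange.eval_nodal, h1, hsub, h4]
    have h5 : ((-1 : ℝ) ^ m) ≠ 0 := by simp
    field_simp
  -- The residue at `k = m` is `binom(2m,m)`; dividing by it makes the polynomial monic.
  refine ⟨fun k => Lagrange.nodalWeight (range (m + 1)) v k * P.eval (v k) /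
    ((2 * m).choose m : ℝ), by simp only [hlead]; exact div_self hc0, fun i hi => ?_⟩
  have hk := key i
  have h6 : ∀ k : ℕ, Lagrange.nodalWeight (range (m + 1)) v k * P.eval (v k) /
      ((2 * m).choose m : ℝ) / ((k : ℝ) + i + 1) =
      (Lagrange.nodalWeight (range (m + 1)) v k * P.eval (v k)) / ((k : ℝ) + i + 1) /
      ((2 * m).choose m : ℝ) := fun k => div_right_comm _ _ _
  simp only [h6]
  rw [← sum_div, hk]
  split_ifs with him
  · subst him
    have h7 := hasc (i + 1)
    have h8 : ∏ k ∈ range (i + 1), ((k : ℝ) + i + 1) =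
        (2 * i + 1) * (((2 * i).choose i : ℝ) * i.factorial) := by
      apply mul_right_cancel₀ hm0
      rw [h7, ← add_assoc, ← two_mul, Nat.factorial_succ, Nat.cast_mul, ← hcen]
      push_cast; ring
    rw [h8, hP, Lagrange.eval_nodal, hsub]
    have h9 : (2 * (i : ℝ) + 1) ≠ 0 := by positivity
    field_simp
  · have : P.eval (i : ℝ) = 0 := by
      rw [hP]
      exact Lagrange.eval_nodal_at_node (s := range m) (v := fun r : ℕ => (r : ℝ))
        (mem_range.2 (lt_of_le_of_ne hi him))
    rw [this]; simp

/-- The monic shifted Legendre polynomial rescaled to `[0, t]`. -/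
noncomputable def scaledPoly (l : ℕ → ℝ) (m : ℕ) (t s : ℝ) : ℝ :=
  ∑ k ∈ Finset.range (m + 1), l k * t ^ (m - k) * s ^ k

theorem continuous_scaledPoly (l : ℕ → ℝ) (m : ℕ) (t : ℝ) : Continuous (scaledPoly l m t) := by
  unfold scaledPoly; fun_prop

theorem abs_scaledPoly_le (l : ℕ → ℝ) (m : ℕ) {t s : ℝ} (hs : 0 ≤ s) (hst : s ≤ t) :
    |scaledPoly l m t s| ≤ (∑ k ∈ Finset.range (m + 1), |l k|) * t ^ m := by
  have ht : 0 ≤ t := hs.trans hst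
  rw [scaledPoly, Finset.sum_mul]
  refine (Finset.abs_sum_le_sum_abs _ _).trans (Finset.sum_le_sum fun k hk => ?_)
  have hk' : k ≤ m := Nat.lt_succ_iff.1 (Finset.mem_range.1 hk)
  rw [abs_mul, abs_mul, abs_of_nonneg (pow_nonneg ht _), abs_of_nonneg (pow_nonneg hs _), mul_assoc]
  refine mul_le_mul_of_nonneg_left ?_ (abs_nonneg _)
  calc t ^ (m - k) * s ^ k ≤ t ^ (m - k) * t ^ k := by gcongr
    _ = t ^ m := by rw [← pow_add, Nat.sub_add_cancel hk']

theorem integral_scaledPoly_mul_pow (l : ℕ → ℝ) (m i : ℕ) (t : ℝ) :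
    ∫ s in (0 : ℝ)..t, scaledPoly l m t s * s ^ i =
      t ^ (m + i + 1) * ∑ k ∈ Finset.range (m + 1), l k / ((k : ℝ) + i + 1) := by
  have h : ∀ s, scaledPoly l m t s * s ^ i =
      ∑ k ∈ Finset.range (m + 1), (l k * t ^ (m - k)) * s ^ (k + i) := by
    intro s
    rw [scaledPoly, Finset.sum_mul]
    exact Finset.sum_congr rfl fun k _ => by ring
  simp_rw [h]
  rw [intervalIntegral.integral_finsetSum fun k _ =>
    (Continuous.intervalIntegrable (by fun_prop) _ _), Finset.mul_sum]
  refine Finset.sum_congr rfl fun k hk => ?_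
  have hk' : k ≤ m := Nat.lt_succ_iff.1 (Finset.mem_range.1 hk)
  rw [intervalIntegral.integral_const_mul, integral_pow]
  have h1 : t ^ (m + i + 1) = t ^ (m - k) * t ^ (k + i + 1) := by
    rw [← pow_add]; congr 1; omega
  rw [h1]; push_cast
  simp only [ne_eq, Nat.add_eq_zero_iff, one_ne_zero, and_false, not_false_eq_true, zero_pow, sub_zero]
  ring

/-- Pairing the rescaled Legendre polynomial with a polynomial of degree at most `m` only sees the
leading coefficient. -/
theorem integral_scaledPoly_mul_sum {l : ℕ → ℝ} {m : ℕ} {N : ℝ}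
    (hl : ∀ i ≤ m, ∑ k ∈ Finset.range (m + 1), l k / ((k : ℝ) + i + 1) = if i = m then N else 0)
    (β : ℕ → ℝ) (t : ℝ) :
    ∫ s in (0 : ℝ)..t, scaledPoly l m t s * ∑ i ∈ Finset.range (m + 1), β i * s ^ i =
      β m * N * t ^ (2 * m + 1) := by
  have h : ∀ s, scaledPoly l m t s * ∑ i ∈ Finset.range (m + 1), β i * s ^ i =
      ∑ i ∈ Finset.range (m + 1), β i * (scaledPoly l m t s * s ^ i) := by
    intro s
    rw [Finset.mul_sum]
    exact Finset.sum_congr rfl fun k _ => by ring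
  simp_rw [h]
  have hc := continuous_scaledPoly l m t
  rw [intervalIntegral.integral_finsetSum fun k _ =>
    (Continuous.intervalIntegrable (by fun_prop) _ _), Finset.sum_eq_single m]
  · rw [intervalIntegral.integral_const_mul, integral_scaledPoly_mul_pow, hl m le_rfl, if_pos rfl,
      two_mul]
    ring
  · intro i hi him
    have hi' : i ≤ m := Nat.lt_succ_iff.1 (Finset.mem_range.1 hi)
    rw [intervalIntegral.integral_const_mul, integral_scaledPoly_mul_pow, hl i hi', if_neg him]
    simp
  · intro h; simp at h

theorem integral_scaledPoly_sq {l : ℕ → ℝ} {m : ℕ} {N : ℝ} (hm : l m = 1)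
    (hl : ∀ i ≤ m, ∑ k ∈ Finset.range (m + 1), l k / ((k : ℝ) + i + 1) = if i = m then N else 0)
    (t : ℝ) :
    ∫ s in (0 : ℝ)..t, scaledPoly l m t s ^ 2 = N * t ^ (2 * m + 1) := by
  have h := integral_scaledPoly_mul_sum hl (fun i => l i * t ^ (m - i)) t
  simp only [hm, Nat.sub_self, pow_zero, mul_one, one_mul] at h
  rw [← h]
  refine intervalIntegral.integral_congr fun s _ => ?_
  simp only [scaledPoly, sq]

/-! ### `L²` estimates on `[0, t]` for vector-valued functions -/

section Vector

variable {E : Type*} [NormedAddCommGroup E] [InnerProductSpace ℂ E]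

/-- Expand `0 ≤ ‖F - r w‖²`. The resulting minorant is affine in `F`, so it can be integrated
against orthogonality relations. -/
theorem two_mul_re_inner_sub_le (F w : E) (r : ℝ) :
    2 * (r * (inner ℂ w F).re) - r ^ 2 * ‖w‖ ^ 2 ≤ ‖F‖ ^ 2 := by
  have h := norm_sub_sq (𝕜 := ℂ) F ((r : ℂ) • w)
  have h2 : RCLike.re (inner ℂ F ((r : ℂ) • w)) = r * (inner ℂ w F).re := by
    rw [inner_smul_right, ← inner_conj_symm, RCLike.re_eq_complex_re, Complex.re_ofReal_mul,
      Complex.conj_re]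
  rw [h2, norm_smul, Complex.norm_real, mul_pow, Real.norm_eq_abs, sq_abs] at h
  nlinarith [sq_nonneg ‖F - (r : ℂ) • w‖]

/-- A lower bound for the `L²` norm on `[0, t]` of a function that agrees to order `m` with a vector
polynomial, in terms of the leading coefficient. -/
theorem integral_norm_sq_lower {l : ℕ → ℝ} {m : ℕ} {N : ℝ} (hm : l m = 1)
    (hl : ∀ i ≤ m, ∑ k ∈ Finset.range (m + 1), l k / ((k : ℝ) + i + 1) = if i = m then N else 0)
    {F : ℝ → E} (hF : Continuous F) {p : ℕ → E} {K t : ℝ} (ht : 0 ≤ t)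
    (hK : ∀ s, 0 ≤ s → s ≤ t →
      ‖F s - ∑ i ∈ Finset.range (m + 1), ((s : ℂ) ^ i) • p i‖ ≤ K * t ^ (m + 1)) :
    N * t ^ (2 * m + 1) * ‖p m‖ ^ 2 -
      2 * (∑ k ∈ Finset.range (m + 1), |l k|) * K * ‖p m‖ * t ^ (2 * m + 2) ≤
      ∫ s in (0 : ℝ)..t, ‖F s‖ ^ 2 := by
  set L := ∑ k ∈ Finset.range (m + 1), |l k| with hL
  have hL0 : 0 ≤ L := Finset.sum_nonneg fun _ _ => abs_nonneg _
  set w := p m with hw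
  set β : ℕ → ℝ := fun i => (inner ℂ w (p i)).re with hβ
  have hc := continuous_scaledPoly l m t
  have hpt : ∀ s ∈ Set.Icc (0 : ℝ) t,
      2 * (scaledPoly l m t s * ∑ i ∈ Finset.range (m + 1), β i * s ^ i) -
        scaledPoly l m t s ^ 2 * ‖w‖ ^ 2 - 2 * L * K * ‖w‖ * t ^ (2 * m + 1) ≤ ‖F s‖ ^ 2 := by
    intro s hs
    -- With `r` the Legendre polynomial, the lower coefficients `p i` integrate to zero, and the two
    -- leading terms combine as `2 - 1 = 1` times `N t^(2m+1) ‖w‖²`.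
    refine le_trans ?_ (two_mul_re_inner_sub_le (F s) w (scaledPoly l m t s))
    set R := F s - ∑ i ∈ Finset.range (m + 1), ((s : ℂ) ^ i) • p i with hR
    have h1 : (inner ℂ w (F s)).re = ∑ i ∈ Finset.range (m + 1), β i * s ^ i + (inner ℂ w R).re := by
      have : F s = ∑ i ∈ Finset.range (m + 1), ((s : ℂ) ^ i) • p i + R := by rw [hR]; abel
      rw [this, inner_add_right, inner_sum, Complex.add_re, Complex.re_sum]
      congr 1
      refine Finset.sum_congr rfl fun i _ => ?_
      rw [inner_smul_right, ← Complex.ofReal_pow, Complex.re_ofReal_mul, mul_comm]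
    have h2 : |(inner ℂ w R).re| ≤ ‖w‖ * (K * t ^ (m + 1)) :=
      (Complex.abs_re_le_norm _).trans ((norm_inner_le_norm w R).trans
        (mul_le_mul_of_nonneg_left (hK s hs.1 hs.2) (norm_nonneg _)))
    have h3 := abs_scaledPoly_le l m hs.1 hs.2
    have h4 : |scaledPoly l m t s * (inner ℂ w R).re| ≤ (L * t ^ m) * (‖w‖ * (K * t ^ (m + 1))) := by
      rw [abs_mul]
      exact mul_le_mul h3 h2 (abs_nonneg _) (by positivity)
    have h5 := (abs_le.1 h4).1
    have h6 : (L * t ^ m) * (‖w‖ * (K * t ^ (m + 1))) = L * K * ‖w‖ * t ^ (2 * m + 1) := by ring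
    rw [h1]
    nlinarith
  have hmono := intervalIntegral.integral_mono_on (μ := MeasureTheory.volume) ht
    (Continuous.intervalIntegrable (by fun_prop) _ _)
    (Continuous.intervalIntegrable (by fun_prop) _ _) hpt
  refine le_trans (le_of_eq ?_) hmono
  rw [intervalIntegral.integral_sub (Continuous.intervalIntegrable (by fun_prop) _ _)
    (Continuous.intervalIntegrable (by fun_prop) _ _),
    intervalIntegral.integral_sub (Continuous.intervalIntegrable (by fun_prop) _ _)
    (Continuous.intervalIntegrable (by fun_prop) _ _),
    intervalIntegral.integral_const_mul, intervalIntegral.integral_mul_const,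
    integral_scaledPoly_mul_sum hl, integral_scaledPoly_sq hm hl, intervalIntegral.integral_const]
  have : β m = ‖w‖ ^ 2 := by
    simp only [hβ, ← hw]
    exact inner_self_eq_norm_sq (𝕜 := ℂ) w
  rw [this, smul_eq_mul]
  ring

theorem integral_norm_sq_upper {l : ℕ → ℝ} {m : ℕ} {N : ℝ} (hm : l m = 1)
    (hl : ∀ i ≤ m, ∑ k ∈ Finset.range (m + 1), l k / ((k : ℝ) + i + 1) = if i = m then N else 0)
    {F : ℝ → E} (hF : Continuous F) {w : E} {K t : ℝ} (hK0 : 0 ≤ K) (ht : 0 ≤ t) (ht1 : t ≤ 1)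
    (hK : ∀ s, 0 ≤ s → s ≤ t → ‖F s - (scaledPoly l m t s : ℂ) • w‖ ≤ K * t ^ (m + 1)) :
    ∫ s in (0 : ℝ)..t, ‖F s‖ ^ 2 ≤ N * t ^ (2 * m + 1) * ‖w‖ ^ 2 +
      (2 * (∑ k ∈ Finset.range (m + 1), |l k|) * K * ‖w‖ + K ^ 2) * t ^ (2 * m + 2) := by
  set L := ∑ k ∈ Finset.range (m + 1), |l k| with hL
  have hL0 : 0 ≤ L := Finset.sum_nonneg fun _ _ => abs_nonneg _
  have hc := continuous_scaledPoly l m t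
  have hpt : ∀ s ∈ Set.Icc (0 : ℝ) t, ‖F s‖ ^ 2 ≤
      scaledPoly l m t s ^ 2 * ‖w‖ ^ 2 + (2 * L * K * ‖w‖ + K ^ 2) * t ^ (2 * m + 1) := by
    intro s hs
    have h1 : ‖F s‖ ≤ |scaledPoly l m t s| * ‖w‖ + K * t ^ (m + 1) := by
      have h := norm_add_le (F s - (scaledPoly l m t s : ℂ) • w) ((scaledPoly l m t s : ℂ) • w)
      rw [sub_add_cancel, norm_smul, Complex.norm_real, Real.norm_eq_abs] at h
      linarith [hK s hs.1 hs.2]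
    have h3 := abs_scaledPoly_le l m hs.1 hs.2
    have h4 : |scaledPoly l m t s| * ‖w‖ * (K * t ^ (m + 1)) ≤
        L * K * ‖w‖ * t ^ (2 * m + 1) :=
      calc |scaledPoly l m t s| * ‖w‖ * (K * t ^ (m + 1)) ≤ (L * t ^ m) * ‖w‖ * (K * t ^ (m + 1)) := by
            gcongr
        _ = _ := by ring
    have h5 : (K * t ^ (m + 1)) ^ 2 ≤ K ^ 2 * t ^ (2 * m + 1) := by
      rw [mul_pow, ← pow_mul]
      exact mul_le_mul_of_nonneg_left (pow_le_pow_of_le_one ht ht1 (by omega)) (sq_nonneg _)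
    calc ‖F s‖ ^ 2 ≤ (|scaledPoly l m t s| * ‖w‖ + K * t ^ (m + 1)) ^ 2 := by gcongr
      _ = scaledPoly l m t s ^ 2 * ‖w‖ ^ 2 + 2 * (|scaledPoly l m t s| * ‖w‖ * (K * t ^ (m + 1))) +
          (K * t ^ (m + 1)) ^ 2 := by rw [← sq_abs (scaledPoly l m t s)]; ring
      _ ≤ _ := by linarith
  have hmono := intervalIntegral.integral_mono_on (μ := MeasureTheory.volume) ht
    (Continuous.intervalIntegrable (by fun_prop) _ _)
    (Continuous.intervalIntegrable (by fun_prop) _ _) hpt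
  refine hmono.trans (le_of_eq ?_)
  rw [intervalIntegral.integral_add (Continuous.intervalIntegrable (by fun_prop) _ _)
    (Continuous.intervalIntegrable (by fun_prop) _ _), intervalIntegral.integral_mul_const,
    integral_scaledPoly_sq hm hl, intervalIntegral.integral_const, smul_eq_mul]
  ring

end Vector

/-! ### The semigroup: Taylor expansion and energy identity -/

section Semigroup

variable {E : Type*} [NormedAddCommGroup E] [InnerProductSpace ℂ E] [CompleteSpace E]

/-- The semigroup `exp (-s b)` generated by `-b`. -/
noncomputable def semigroup (b : E →L[ℂ] E) (s : ℝ) : E →L[ℂ] E :=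
  NormedSpace.exp (-((s : ℂ) • b))

theorem semigroup_zero (b : E →L[ℂ] E) : semigroup b 0 = 1 := by
  simp [semigroup, NormedSpace.exp_zero]

theorem hasDerivAt_semigroup (b : E →L[ℂ] E) (s : ℝ) :
    HasDerivAt (semigroup b) (-(b * semigroup b s)) s := by
  have h := hasDerivAt_exp_smul_const' (𝕂 := ℂ) (-b) (s : ℂ)
  have h2 := h.scomp s (Complex.ofRealCLM.hasDerivAt (x := s))
  simp only [Function.comp_def, Complex.ofRealCLM_apply, Complex.ofReal_one, one_smul, smul_neg,
    neg_mul] at h2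
  exact h2

theorem hasDerivAt_semigroup_apply (b : E →L[ℂ] E) (x : E) (s : ℝ) :
    HasDerivAt (fun s => semigroup b s x) (-(b (semigroup b s x))) s := by
  have h := (hasDerivAt_semigroup b s)
  have h2 := ((ContinuousLinearMap.apply ℂ E x).restrictScalars ℝ).hasFDerivAt.comp_hasDerivAt s h
  exact h2

theorem continuous_semigroup (b : E →L[ℂ] E) : Continuous (semigroup b) :=
  continuous_iff_continuousAt.2 fun s => (hasDerivAt_semigroup b s).continuousAt

/-- Taylor expansion of the semigroup, with a uniform remainder bound on `[0, 1]`. -/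
theorem exists_semigroup_taylor (b : E →L[ℂ] E) (k : ℕ) : ∃ K : ℝ, 0 ≤ K ∧ ∀ s : ℝ, 0 ≤ s → s ≤ 1 →
    ‖semigroup b s - ∑ i ∈ Finset.range k, ((s : ℂ) ^ i) • (((-1) ^ i / (i.factorial : ℂ)) • b ^ i)‖
      ≤ K * s ^ k := by
  induction k with
  | zero =>
    obtain ⟨K, hK⟩ := isCompact_Icc.exists_bound_of_continuousOn
      (continuous_semigroup b).continuousOn (s := Set.Icc (0 : ℝ) 1)
    refine ⟨K, (norm_nonneg _).trans (hK 0 (by simp)), fun s hs hs1 => ?_⟩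
    simpa using hK s ⟨hs, hs1⟩
  | succ k ih =>
    obtain ⟨K, hK0, hK⟩ := ih
    refine ⟨‖b‖ * K, by positivity, fun s hs hs1 => ?_⟩
    set R : ℕ → ℝ → (E →L[ℂ] E) := fun k s => semigroup b s -
      ∑ i ∈ Finset.range k, ((s : ℂ) ^ i) • (((-1) ^ i / (i.factorial : ℂ)) • b ^ i) with hR
    -- Differentiating a remainder gives `-b` times the previous one, so each order follows from the
    -- mean value inequality at the cost of a factor `‖b‖ s`.
    have hderiv : ∀ r : ℝ, HasDerivAt (R (k + 1)) (-(b * R k r)) r := by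
      intro r
      have h1 : ∀ i : ℕ, HasDerivAt
          (fun s : ℝ => ((s : ℂ) ^ i) • (((-1) ^ i / (i.factorial : ℂ)) • b ^ i))
          (((i : ℂ) * (r : ℂ) ^ (i - 1)) • (((-1) ^ i / (i.factorial : ℂ)) • b ^ i)) r := by
        intro i
        have := ((hasDerivAt_pow i (r : ℂ)).comp_ofReal).smul_const
          (((-1) ^ i / (i.factorial : ℂ)) • b ^ i)
        exact this
      have h2 := (hasDerivAt_semigroup b r).sub
        (HasDerivAt.fun_sum fun i (_ : i ∈ Finset.range (k + 1)) => h1 i)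
      refine h2.congr_deriv ?_
      simp only [hR]
      rw [mul_sub, neg_sub, Finset.sum_range_succ', Finset.mul_sum]
      have h3 : ∀ i : ℕ, (((i + 1 : ℕ) : ℂ) * (r : ℂ) ^ (i + 1 - 1)) •
          (((-1) ^ (i + 1) / ((i + 1).factorial : ℂ)) • b ^ (i + 1)) =
          -(b * (((r : ℂ) ^ i) • (((-1) ^ i / (i.factorial : ℂ)) • b ^ i))) := by
        intro i
        rw [mul_smul_comm, mul_smul_comm, ← pow_succ', smul_smul, smul_smul, ← neg_smul,
          Nat.factorial_succ, Nat.add_sub_cancel]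
        congr 1
        have : (i.factorial : ℂ) ≠ 0 := by exact_mod_cast i.factorial_ne_zero
        have : ((i : ℂ) + 1) ≠ 0 := by exact_mod_cast i.succ_ne_zero
        push_cast
        field_simp
        ring
      simp only [h3]
      simp only [Finset.sum_neg_distrib]
      simp
      abel
    have hbound : ∀ r ∈ Set.Icc (0 : ℝ) s, ‖-(b * R k r)‖ ≤ ‖b‖ * K * s ^ k := by
      intro r hr
      rw [norm_neg, mul_assoc]
      refine (norm_mul_le _ _).trans (mul_le_mul_of_nonneg_left ?_ (norm_nonneg _))
      exact (hK r hr.1 (hr.2.trans hs1)).trans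
        (mul_le_mul_of_nonneg_left (pow_le_pow_left₀ hr.1 hr.2 k) hK0)
    have hmv := (convex_Icc (0 : ℝ) s).norm_image_sub_le_of_norm_hasDerivWithin_le
      (fun r _ => (hderiv r).hasDerivWithinAt) hbound (Set.left_mem_Icc.2 hs) (Set.right_mem_Icc.2 hs)
    have hR0 : R (k + 1) 0 = 0 := by
      simp only [hR, Finset.sum_range_succ']
      simp [semigroup_zero]
    rw [hR0, sub_zero, sub_zero, Real.norm_eq_abs, abs_of_nonneg hs] at hmv
    calc ‖R (k + 1) s‖ ≤ ‖b‖ * K * s ^ k * s := hmv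
      _ = _ := by ring

/-- The energy identity for a generator whose dissipation is `‖d x‖ ^ 2`. -/
theorem norm_sq_semigroup {b d : E →L[ℂ] E} (hbd : ∀ x, (inner ℂ x (b x)).re = ‖d x‖ ^ 2) (x : E)
    (t : ℝ) :
    ‖semigroup b t x‖ ^ 2 = ‖x‖ ^ 2 - 2 * ∫ s in (0 : ℝ)..t, ‖d (semigroup b s x)‖ ^ 2 := by
  have hcu : Continuous fun s => semigroup b s x :=
    continuous_iff_continuousAt.2 fun s => (hasDerivAt_semigroup_apply b x s).continuousAt
  have hderiv : ∀ s : ℝ, HasDerivAt (fun s => ‖semigroup b s x‖ ^ 2)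
      (-2 * ‖d (semigroup b s x)‖ ^ 2) s := by
    intro s
    let : InnerProductSpace ℝ E := InnerProductSpace.rclikeToReal ℂ E
    have h := (hasDerivAt_semigroup_apply b x s).norm_sq
    refine h.congr_deriv ?_
    have h1 : inner ℝ (semigroup b s x) (-(b (semigroup b s x))) = -‖d (semigroup b s x)‖ ^ 2 := by
      rw [inner_neg_right, ← hbd]
      rfl
    rw [h1]; ring
  have h := intervalIntegral.integral_eq_sub_of_hasDerivAt (a := 0) (b := t)
    (fun s _ => hderiv s) (Continuous.intervalIntegrable (by fun_prop) _ _)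
  rw [intervalIntegral.integral_const_mul, semigroup_zero] at h
  simp only [one_apply_eq_self] at h
  linarith

end Semigroup

/-! ### The universal constant and a square-root estimate -/

/-- The universal factor `1 / ((2m+1)! * binom(2m, m))`. -/
noncomputable def decayFactor (m : ℕ) : ℝ :=
  1 / (((2 * m + 1).factorial : ℝ) * ((2 * m).choose m : ℝ))

theorem choose_two_mul_pos (m : ℕ) : (0 : ℝ) < ((2 * m).choose m : ℝ) := by
  exact_mod_cast Nat.choose_pos (show m ≤ 2 * m by omega)

theorem decayFactor_pos (m : ℕ) : 0 < decayFactor m := by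
  have := choose_two_mul_pos m
  unfold decayFactor; positivity

theorem decayFactor_eq (m : ℕ) :
    1 / ((2 * m + 1) * ((2 * m).choose m : ℝ) ^ 2) * (1 / (m.factorial : ℝ)) ^ 2 =
      decayFactor m := by
  have h := Nat.choose_mul_factorial_mul_factorial (show m ≤ 2 * m by omega)
  rw [show 2 * m - m = m by omega] at h
  have hm0 : (m.factorial : ℝ) ≠ 0 := by positivity
  have hc := (choose_two_mul_pos m).ne'
  have h1 : (2 * (m : ℝ) + 1) ≠ 0 := by positivity
  rw [decayFactor, Nat.factorial_succ, ← h]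
  push_cast
  field_simp

/-- Extracts the operator norm `y` from a test vector whose norm `X` is only known to be at least `1
- q`. It uses `1 / X² ≤ 1 + 4q`, and `1 - H - 2H² ≤ √(1 - 2H)` for `0 ≤ H ≤ 1/2`. -/
theorem le_of_sq_mul_sq_ge {X y h q : ℝ} (hy : 0 ≤ y) (hq : 0 ≤ q) (hq4 : q ≤ 1 / 4)
    (hX : 1 - q ≤ X) (hh : 0 ≤ h) (hH : h * (1 + 4 * q) ≤ 1 / 2)
    (hle : X ^ 2 - 2 * h ≤ y ^ 2 * X ^ 2) :
    1 - h * (1 + 4 * q) - 2 * (h * (1 + 4 * q)) ^ 2 ≤ y := by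
  have h1 : (1 - q) ^ 2 ≤ X ^ 2 := pow_le_pow_left₀ (by linarith) hX 2
  have hX0 : 0 < X ^ 2 := lt_of_lt_of_le (pow_pos (by linarith) 2) h1
  have h2 : 1 ≤ X ^ 2 * (1 + 4 * q) := by
    refine le_trans ?_ (mul_le_mul_of_nonneg_right h1 (by linarith))
    nlinarith [mul_nonneg hq (sub_nonneg.2 hq4), mul_nonneg (mul_nonneg hq hq) hq]
  have h3 : h ≤ h * (1 + 4 * q) * X ^ 2 := by
    have := mul_le_mul_of_nonneg_left h2 hh
    linarith
  set H := h * (1 + 4 * q)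
  have hH0 : 0 ≤ H := by positivity
  have h4 : 1 - 2 * H ≤ y ^ 2 := by
    have : (1 - 2 * H) * X ^ 2 ≤ y ^ 2 * X ^ 2 := by linarith
    exact le_of_mul_le_mul_right this hX0
  refine (abs_le_of_sq_le_sq' ?_ hy).2
  refine le_trans ?_ h4
  have h5 : 0 ≤ H ^ 2 * (3 - 4 * H - 4 * H ^ 2) := by
    refine mul_nonneg (sq_nonneg _) ?_
    nlinarith
  linarith

/-! ### Two-sided bounds on the dissipation and the norm expansion -/

section Dissipation

variable {E : Type*} [NormedAddCommGroup E] [InnerProductSpace ℂ E]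

theorem norm_neg_one_pow_div_factorial_smul (i : ℕ) (v : E) :
    ‖((-1 : ℂ) ^ i / (i.factorial : ℂ)) • v‖ = 1 / (i.factorial : ℝ) * ‖v‖ := by
  rw [norm_smul, norm_div, norm_pow, norm_neg, norm_one, one_pow, Complex.norm_natCast]

/-- A vector on which the first `m` observables are small is close to their joint kernel. -/
theorem exists_near_joint_kernel [FiniteDimensional ℂ E] (T : ℕ → E →L[ℂ] E) (m : ℕ) :
    ∃ K : ℝ, 0 ≤ K ∧ ∀ x : E, ∃ y : E, (∀ j < m, T j y = 0) ∧
      ‖x - y‖ ≤ K * ∑ j ∈ Finset.range m, ‖T j x‖ := by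
  set L : E →ₗ[ℂ] (Fin m → E) := LinearMap.pi fun j => (T j : E →ₗ[ℂ] E) with hL
  set V := LinearMap.ker L with hV
  -- The stacked map is injective on the orthogonal complement of its kernel, hence bounded below
  -- there by finite dimensionality; `y` is the orthogonal projection of `x`.
  have hker : LinearMap.ker (L ∘ₗ Vᗮ.subtype) = ⊥ := by
    rw [LinearMap.ker_eq_bot']
    intro z hz
    have h1 : (z : E) ∈ V := hz
    have h2 := Submodule.inner_right_of_mem_orthogonal h1 z.2
    exact Subtype.ext (inner_self_eq_zero.1 h2)
  obtain ⟨K, -, hK⟩ := LinearMap.exists_antilipschitzWith _ hker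
  refine ⟨K, K.2, fun x => ⟨V.starProjection x, fun j hj => ?_, ?_⟩⟩
  · have h1 : L (V.starProjection x) = 0 := V.starProjection_apply_mem x
    exact congrFun h1 ⟨j, hj⟩
  · have hz : x - V.starProjection x ∈ Vᗮ := V.sub_starProjection_mem_orthogonal x
    have h1 := ZeroHomClass.bound_of_antilipschitz _ hK ⟨_, hz⟩
    have h3 : L (V.starProjection x) = 0 := V.starProjection_apply_mem x
    simp only [LinearMap.comp_apply, Submodule.subtype_apply, map_sub, h3,
      Submodule.coe_norm] at h1
    refine h1.trans (mul_le_mul_of_nonneg_left ?_ K.2)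
    rw [sub_zero]
    refine (pi_norm_le_iff_of_nonneg (Finset.sum_nonneg fun _ _ => norm_nonneg _)).2 fun j => ?_
    exact Finset.single_le_sum (f := fun j => ‖T j x‖) (fun _ _ => norm_nonneg _)
      (Finset.mem_range.2 j.2)

variable [CompleteSpace E]

theorem continuous_dissipation (b d : E →L[ℂ] E) (x : E) :
    Continuous fun s => d (semigroup b s x) :=
  d.continuous.comp (continuous_iff_continuousAt.2 fun s =>
    (hasDerivAt_semigroup_apply b x s).continuousAt)

theorem exists_dissipation_taylor (b d : E →L[ℂ] E) (k : ℕ) : ∃ K : ℝ, 0 ≤ K ∧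
    ∀ (x : E) (s : ℝ), 0 ≤ s → s ≤ 1 →
      ‖d (semigroup b s x) - ∑ i ∈ Finset.range k,
        ((s : ℂ) ^ i) • (((-1) ^ i / (i.factorial : ℂ)) • d ((b ^ i) x))‖ ≤ K * s ^ k * ‖x‖ := by
  obtain ⟨K, hK0, hK⟩ := exists_semigroup_taylor b k
  refine ⟨‖d‖ * K, by positivity, fun x s hs hs1 => ?_⟩
  have h := (d ∘L (semigroup b s - ∑ i ∈ Finset.range k,
    ((s : ℂ) ^ i) • (((-1) ^ i / (i.factorial : ℂ)) • b ^ i))).le_opNorm x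
  have h2 := ContinuousLinearMap.opNorm_comp_le d (semigroup b s - ∑ i ∈ Finset.range k,
    ((s : ℂ) ^ i) • (((-1) ^ i / (i.factorial : ℂ)) • b ^ i))
  simp only [ContinuousLinearMap.comp_apply, sub_apply,
    sum_apply, smul_apply, map_sub, map_sum, map_smul] at h
  refine h.trans ?_
  refine mul_le_mul_of_nonneg_right (h2.trans ?_) (norm_nonneg _)
  rw [mul_assoc]
  exact mul_le_mul_of_nonneg_left (hK s hs hs1) (norm_nonneg _)

/-- The dissipation up to time `t` controls each of the quantities `‖d (b ^ j x)‖`. -/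
theorem exists_dissipation_lower (b d : E →L[ℂ] E) (j : ℕ) : ∃ K : ℝ, 0 ≤ K ∧
    ∀ (x : E) (t : ℝ), ‖x‖ = 1 → 0 ≤ t → t ≤ 1 →
      decayFactor j * t ^ (2 * j + 1) * ‖d ((b ^ j) x)‖ ^ 2 - K * ‖d ((b ^ j) x)‖ * t ^ (2 * j + 2) ≤
        ∫ s in (0 : ℝ)..t, ‖d (semigroup b s x)‖ ^ 2 := by
  obtain ⟨l, hl1, hl⟩ := exists_legendre_coeff j
  obtain ⟨K, hK0, hK⟩ := exists_dissipation_taylor b d (j + 1)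
  refine ⟨2 * (∑ k ∈ Finset.range (j + 1), |l k|) * K * (1 / (j.factorial : ℝ)), by positivity,
    fun x t hx ht ht1 => ?_⟩
  have h := integral_norm_sq_lower hl1 hl (continuous_dissipation b d x)
    (p := fun i => ((-1) ^ i / (i.factorial : ℂ)) • d ((b ^ i) x)) (K := K) ht
    (fun s hs hst => ?_)
  · rw [norm_neg_one_pow_div_factorial_smul] at h
    refine le_trans (le_of_eq ?_) h
    rw [← decayFactor_eq]
    ring
  · refine (hK x s hs (hst.trans ht1)).trans ?_
    rw [hx, mul_one]
    gcongr

/-- The lower bound on the dissipation, uniform over the unit sphere. -/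
theorem exists_dissipation_uniform_lower [FiniteDimensional ℂ E] (b d : E →L[ℂ] E) (m : ℕ) {σ : ℝ}
    (hσ : 0 ≤ σ) (hmin : ∀ y, (∀ j < m, d ((b ^ j) y) = 0) → σ * ‖y‖ ≤ ‖d ((b ^ m) y)‖) :
    ∃ K : ℝ, 0 ≤ K ∧ ∀ (x : E) (t : ℝ), ‖x‖ = 1 → 0 ≤ t → t ≤ 1 →
      decayFactor m * σ ^ 2 * t ^ (2 * m + 1) - K * t ^ (2 * m + 2) ≤
        ∫ s in (0 : ℝ)..t, ‖d (semigroup b s x)‖ ^ 2 := by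
  choose K hK0 hK using exists_dissipation_lower b d
  obtain ⟨D, hD0, hD⟩ := exists_near_joint_kernel (fun j => d ∘L (b ^ j)) m
  set c := decayFactor m * σ ^ 2 with hc
  have hc0 : 0 ≤ c := mul_nonneg (decayFactor_pos m).le (sq_nonneg _)
  -- Large enough that `‖d (b ^ j x)‖ > M j * t` for some `j < m` already forces a dissipation above
  -- `c t^(2m+1)`.
  set M : ℕ → ℝ := fun j => (K j + c) / decayFactor j + 1 with hM
  have hM1 : ∀ j, 1 ≤ M j := fun j => by
    have := div_nonneg (add_nonneg (hK0 j) hc0) (decayFactor_pos j).le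
    simp only [hM]; linarith
  set G := ‖d ∘L (b ^ m)‖ with hG
  set δ := D * ∑ j ∈ Finset.range m, M j with hδ
  have hδ0 : 0 ≤ δ := mul_nonneg hD0 (Finset.sum_nonneg fun j _ => zero_le_one.trans (hM1 j))
  set η := δ * (σ + G) with hη
  have hG0 : 0 ≤ G := norm_nonneg _
  refine ⟨decayFactor m * (2 * σ * η) + K m * G, ?_, fun x t hx ht ht1 => ?_⟩
  · have := (decayFactor_pos m).le
    have := hK0 m
    positivity
  have hpow0 : 0 ≤ t ^ (2 * m + 2) := by positivity
  have hKK : 0 ≤ decayFactor m * (2 * σ * η) + K m * G := by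
    have := (decayFactor_pos m).le
    have := hK0 m
    positivity
  -- Either the bound holds outright, or all lower observables are `O(t)`, so `x` is `O(t)`-close to
  -- the joint kernel and `hmin` applies up to that error.
  by_cases hcase : c * t ^ (2 * m + 1) ≤ ∫ s in (0 : ℝ)..t, ‖d (semigroup b s x)‖ ^ 2
  · have := mul_nonneg hKK hpow0
    linarith
  push Not at hcase
  have ht0 : 0 < t := by
    rcases ht.eq_or_lt with h | h
    · rw [← h] at hcase; simp at hcase
    · exact h
  have hsmall : ∀ j < m, ‖d ((b ^ j) x)‖ ≤ M j * t := by
    intro j hj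
    by_contra! hlt
    set q := ‖d ((b ^ j) x)‖ with hq
    have h1 := (hK j x t hx ht ht1).trans hcase.le
    -- From `j < m` one gets `2j + 3 ≤ 2m + 1`: exactly the two spare powers of `t` needed against
    -- `(M j * t)²`.
    have h2 : t ^ (2 * m + 1) ≤ t ^ (2 * j + 1) * t ^ 2 := by
      rw [← pow_add]
      exact pow_le_pow_of_le_one ht ht1 (by omega)
    have h3 : t ^ (2 * j + 1) * (decayFactor j * q ^ 2 - K j * q * t) ≤
        t ^ (2 * j + 1) * (c * t ^ 2) := by
      have : t ^ (2 * j + 2) = t ^ (2 * j + 1) * t := by ring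
      rw [this] at h1
      nlinarith [mul_le_mul_of_nonneg_left h2 hc0]
    have h4 := le_of_mul_le_mul_left h3 (by positivity)
    have h5 : decayFactor j * M j = K j + c + decayFactor j := by
      have := (decayFactor_pos j).ne'
      simp only [hM]; field_simp
    have hd := decayFactor_pos j
    have hMj := hM1 j
    have h6 : (K j + c + decayFactor j) * t < decayFactor j * q := by
      rw [← h5, mul_assoc]; exact mul_lt_mul_of_pos_left hlt hd
    have h7 : t < q := lt_of_le_of_lt (by nlinarith) hlt
    have h8 : 0 < (decayFactor j * q - K j * t) - c * t := by
      nlinarith [mul_pos hd ht0]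
    have h9 : 0 < q - t := by linarith
    nlinarith [mul_pos h8 (ht0.trans h7), mul_nonneg (mul_nonneg hc0 ht) h9.le]
  obtain ⟨y, hy0, hyd⟩ := hD x
  have hxy : ‖x - y‖ ≤ δ * t := by
    refine hyd.trans ?_
    rw [hδ, mul_assoc, Finset.sum_mul]
    exact mul_le_mul_of_nonneg_left
      (Finset.sum_le_sum fun j hj => hsmall j (Finset.mem_range.1 hj)) hD0
  have hy1 : 1 - δ * t ≤ ‖y‖ := by
    have := norm_sub_norm_le x y
    linarith
  have hdiff : ‖d ((b ^ m) y)‖ - ‖d ((b ^ m) x)‖ ≤ G * (δ * t) := by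
    refine (norm_sub_norm_le _ _).trans ?_
    rw [← map_sub, ← map_sub]
    refine ((d ∘L (b ^ m)).le_opNorm (y - x)).trans ?_
    rw [norm_sub_rev]
    exact mul_le_mul_of_nonneg_left hxy hG0
  have hrG : ‖d ((b ^ m) x)‖ ≤ G := by
    have := (d ∘L (b ^ m)).le_opNorm x
    rwa [hx, mul_one] at this
  set r := ‖d ((b ^ m) x)‖ with hr
  have hr0 : 0 ≤ r := norm_nonneg _
  have hlow : σ - η * t ≤ r := by
    have h1 := hmin y hy0
    have h2 := mul_le_mul_of_nonneg_left hy1 hσ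
    have h3 : σ * (1 - δ * t) - G * (δ * t) = σ - η * t := by rw [hη]; ring
    linarith
  have hsq : σ ^ 2 - 2 * σ * η * t ≤ r ^ 2 := by
    have hηt : 0 ≤ η * t := by positivity
    rcases le_total (σ - η * t) 0 with h | h
    · have e1 : 0 ≤ σ * (η * t - σ) := mul_nonneg hσ (by linarith)
      have e2 : 0 ≤ σ * (η * t) := mul_nonneg hσ hηt
      have e3 : 0 ≤ r ^ 2 := sq_nonneg r
      linarith
    · have e1 := mul_self_le_mul_self h hlow
      have e2 := sq_nonneg (η * t)
      linarith
  have h1 := hK m x t hx ht ht1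
  have h2 := mul_le_mul_of_nonneg_left hsq
    (mul_nonneg (decayFactor_pos m).le (pow_nonneg ht (2 * m + 1)))
  have h3 : K m * r * t ^ (2 * m + 2) ≤ K m * G * t ^ (2 * m + 2) :=
    mul_le_mul_of_nonneg_right (mul_le_mul_of_nonneg_left hrG (hK0 m)) hpow0
  have h4 : decayFactor m * t ^ (2 * m + 1) * (σ ^ 2 - 2 * σ * η * t) =
      c * t ^ (2 * m + 1) - decayFactor m * (2 * σ * η) * t ^ (2 * m + 2) := by
    rw [hc]; ring
  linarith

/-- Near-optimal initial data: a polynomial in `t b` applied to a vector of the joint kernel. -/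
theorem exists_dissipation_upper (b d : E →L[ℂ] E) (m : ℕ) (x₀ : E)
    (hker : ∀ j < m, d ((b ^ j) x₀) = 0) :
    ∃ K : ℝ, 0 ≤ K ∧ ∀ t : ℝ, 0 ≤ t → t ≤ 1 → ∃ x : E, ‖x - x₀‖ ≤ K * t ∧
      ∫ s in (0 : ℝ)..t, ‖d (semigroup b s x)‖ ^ 2 ≤
        decayFactor m * ‖d ((b ^ m) x₀)‖ ^ 2 * t ^ (2 * m + 1) + K * t ^ (2 * m + 2) := by
  obtain ⟨l, hl1, hl⟩ := exists_legendre_coeff m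
  choose K hK0 hK using exists_dissipation_taylor b d
  -- On the joint kernel, `d (semigroup b s (b ^ (m-k) x₀))` starts with `(-s)^k / k! · d (b ^ m
  -- x₀)`. These weights make the sum equal `scaledPoly l m t s • w` to leading order, and `a m = 1`
  -- keeps `x` within `O(t)` of `x₀`.
  set a : ℕ → ℝ := fun k => (-1) ^ (m - k) * k.factorial * l k / m.factorial with ha
  have ham : a m = 1 := by
    have : (m.factorial : ℝ) ≠ 0 := by positivity
    simp only [ha, hl1, Nat.sub_self, pow_zero, one_mul, mul_one]
    exact div_self this
  set w : E := ((-1) ^ m / (m.factorial : ℂ)) • d ((b ^ m) x₀) with hw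
  have hwn : ‖w‖ = 1 / (m.factorial : ℝ) * ‖d ((b ^ m) x₀)‖ :=
    norm_neg_one_pow_div_factorial_smul _ _
  set L := ∑ k ∈ Finset.range (m + 1), |l k| with hL
  have hL0 : 0 ≤ L := Finset.sum_nonneg fun _ _ => abs_nonneg _
  set K₁ := ∑ k ∈ Finset.range (m + 1), |a k| * (K (k + 1) * ‖(b ^ (m - k)) x₀‖) with hK₁
  have hK₁0 : 0 ≤ K₁ := Finset.sum_nonneg fun k _ =>
    mul_nonneg (abs_nonneg _) (mul_nonneg (hK0 _) (norm_nonneg _))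
  set K₂ := ∑ k ∈ Finset.range m, |a k| * ‖(b ^ (m - k)) x₀‖ with hK₂
  have hK₂0 : 0 ≤ K₂ := Finset.sum_nonneg fun k _ => mul_nonneg (abs_nonneg _) (norm_nonneg _)
  set K₃ := 2 * L * K₁ * ‖w‖ + K₁ ^ 2 with hK₃
  have hK₃0 : 0 ≤ K₃ := by positivity
  refine ⟨K₂ + K₃, by positivity, fun t ht ht1 => ?_⟩
  set x : E := ∑ k ∈ Finset.range (m + 1), ((a k * t ^ (m - k) : ℝ) : ℂ) • (b ^ (m - k)) x₀ with hx
  refine ⟨x, ?_, ?_⟩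
  · have h1 : x - x₀ = ∑ k ∈ Finset.range m, ((a k * t ^ (m - k) : ℝ) : ℂ) • (b ^ (m - k)) x₀ := by
      rw [hx, Finset.sum_range_succ, ham]
      simp
    rw [h1]
    calc _ ≤ ∑ k ∈ Finset.range m, |a k| * ‖(b ^ (m - k)) x₀‖ * t := by
          refine norm_sum_le_of_le _ fun k hk => ?_
          have hk' := Finset.mem_range.1 hk
          rw [norm_smul, Complex.norm_real, Real.norm_eq_abs, abs_mul,
            abs_of_nonneg (pow_nonneg ht _)]
          have : t ^ (m - k) ≤ t := pow_le_of_le_one ht ht1 (by omega)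
          calc |a k| * t ^ (m - k) * ‖(b ^ (m - k)) x₀‖ ≤ |a k| * t * ‖(b ^ (m - k)) x₀‖ := by
                gcongr
            _ = _ := by ring
      _ = K₂ * t := by rw [hK₂, Finset.sum_mul]
      _ ≤ _ := mul_le_mul_of_nonneg_right (by linarith) ht
  · have h := integral_norm_sq_upper hl1 hl (continuous_dissipation b d x) (w := w) hK₁0 ht ht1
      (fun s hs hst => ?_)
    · refine h.trans ?_
      rw [hwn, mul_pow, ← hwn]
      have h2 : 0 ≤ K₂ * t ^ (2 * m + 2) := by positivity
      have h3 := decayFactor_eq m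
      have h4 : 1 / ((2 * (m : ℝ) + 1) * ((2 * m).choose m : ℝ) ^ 2) * t ^ (2 * m + 1) *
          ((1 / (m.factorial : ℝ)) ^ 2 * ‖d ((b ^ m) x₀)‖ ^ 2) =
          decayFactor m * ‖d ((b ^ m) x₀)‖ ^ 2 * t ^ (2 * m + 1) := by
        rw [← h3]; ring
      rw [h4]
      linarith
    · have hs1 := hst.trans ht1
      have h1 : d (semigroup b s x) - (scaledPoly l m t s : ℂ) • w =
          ∑ k ∈ Finset.range (m + 1), ((a k * t ^ (m - k) : ℝ) : ℂ) •
            (d (semigroup b s ((b ^ (m - k)) x₀)) -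
              ((s : ℂ) ^ k * ((-1) ^ k / (k.factorial : ℂ))) • d ((b ^ m) x₀)) := by
        rw [hx]
        simp only [map_sum, map_smul, smul_sub, Finset.sum_sub_distrib]
        congr 1
        rw [hw, scaledPoly, smul_smul, Complex.ofReal_sum, Finset.sum_mul, Finset.sum_smul]
        refine Finset.sum_congr rfl fun k hk => ?_
        have hk' : k ≤ m := Nat.lt_succ_iff.1 (Finset.mem_range.1 hk)
        rw [smul_smul]
        congr 1
        have e1 : ((k.factorial : ℕ) : ℂ) ≠ 0 := by exact_mod_cast k.factorial_ne_zero
        have e2 : ((m.factorial : ℕ) : ℂ) ≠ 0 := by exact_mod_cast m.factorial_ne_zero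
        have e3 : ((-1 : ℂ)) ^ m = (-1) ^ (m - k) * (-1) ^ k := by
          rw [← pow_add, Nat.sub_add_cancel hk']
        simp only [ha]
        push_cast
        rw [e3]
        field_simp
      rw [h1, hK₁, Finset.sum_mul]
      refine norm_sum_le_of_le _ fun k hk => ?_
      have hk' : k ≤ m := Nat.lt_succ_iff.1 (Finset.mem_range.1 hk)
      have h2 := hK (k + 1) ((b ^ (m - k)) x₀) s hs hs1
      have h3 : ∑ i ∈ Finset.range (k + 1), ((s : ℂ) ^ i) • (((-1) ^ i / (i.factorial : ℂ)) •
          d ((b ^ i) ((b ^ (m - k)) x₀))) =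
          ((s : ℂ) ^ k * ((-1) ^ k / (k.factorial : ℂ))) • d ((b ^ m) x₀) := by
        have hp : ∀ i, (b ^ i) ((b ^ (m - k)) x₀) = (b ^ (i + (m - k))) x₀ := fun i => by
          rw [pow_add]; rfl
        rw [Finset.sum_eq_single k]
        · rw [hp, Nat.add_sub_cancel' hk', smul_smul]
        · intro i hi hik
          have hi' := Finset.mem_range.1 hi
          rw [hp, hker _ (by omega), smul_zero, smul_zero]
        · intro h; simp at h
      rw [h3] at h2
      rw [norm_smul, Complex.norm_real, Real.norm_eq_abs, abs_mul, abs_of_nonneg (pow_nonneg ht _)]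
      calc _ ≤ |a k| * t ^ (m - k) * (K (k + 1) * t ^ (k + 1) * ‖(b ^ (m - k)) x₀‖) := by
            have := hK0 (k + 1)
            refine mul_le_mul_of_nonneg_left (h2.trans ?_) (by positivity)
            gcongr
        _ = |a k| * (K (k + 1) * ‖(b ^ (m - k)) x₀‖) * (t ^ (m - k) * t ^ (k + 1)) := by ring
        _ = _ := by rw [← pow_add, show m - k + (k + 1) = m + 1 by omega]

/-- Short-time expansion of the norm of the semigroup. -/
theorem exists_norm_semigroup_expansion [FiniteDimensional ℂ E] {b d : E →L[ℂ] E}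
    (hbd : ∀ x, (inner ℂ x (b x)).re = ‖d x‖ ^ 2) (m : ℕ) {x₀ : E} (hx₀ : ‖x₀‖ = 1)
    (hker : ∀ j < m, d ((b ^ j) x₀) = 0)
    (hmin : ∀ y, (∀ j < m, d ((b ^ j) y) = 0) → ‖d ((b ^ m) x₀)‖ * ‖y‖ ≤ ‖d ((b ^ m) y)‖) :
    ∃ δ : ℝ, 0 < δ ∧ ∃ M : ℝ, ∀ t : ℝ, 0 ≤ t → t < δ →
      |‖semigroup b t‖ - (1 - decayFactor m * ‖d ((b ^ m) x₀)‖ ^ 2 * t ^ (2 * m + 1))| ≤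
        M * t ^ (2 * m + 2) := by
  obtain ⟨K, hK0, hK⟩ := exists_dissipation_uniform_lower b d m (norm_nonneg (d ((b ^ m) x₀))) hmin
  obtain ⟨Q, hQ0, hQ⟩ := exists_dissipation_upper b d m x₀ hker
  set c := decayFactor m * ‖d ((b ^ m) x₀)‖ ^ 2 with hc
  have hc0 : 0 ≤ c := mul_nonneg (decayFactor_pos m).le (sq_nonneg _)
  -- `C₁` collects the `p t` terms of `H = h (1 + 4Qt)`, and `C₀` bounds `H / p`. The radius below
  -- keeps `t`, `Q t` and `C₀ t` at most `1/4`.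
  set C₁ := Q + 4 * Q * c + 4 * Q ^ 2 with hC₁
  have hC₁0 : 0 ≤ C₁ := by positivity
  set C₀ := c + C₁ with hC₀
  have hC₀0 : 0 ≤ C₀ := by positivity
  refine ⟨1 / (4 * (1 + Q + C₀)), by positivity, max K (C₁ + 2 * C₀ ^ 2), fun t ht htδ => ?_⟩
  rw [lt_div_iff₀ (by positivity)] at htδ
  have ht1 : t ≤ 1 / 4 := by nlinarith [mul_nonneg ht hQ0, mul_nonneg ht hC₀0]
  have hQt : Q * t ≤ 1 / 4 := by nlinarith [mul_nonneg ht hQ0, mul_nonneg ht hC₀0]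
  have hCt : C₀ * t ≤ 1 / 4 := by nlinarith [mul_nonneg ht hQ0, mul_nonneg ht hC₀0]
  have ht1' : t ≤ 1 := by linarith
  set p := t ^ (2 * m + 1) with hp
  have hp0 : 0 ≤ p := pow_nonneg ht _
  have hpt : t ^ (2 * m + 2) = p * t := by rw [hp]; ring
  have hple : p ≤ t := pow_le_of_le_one ht ht1' (by omega)
  rw [hpt]
  have hupper : ‖semigroup b t‖ ≤ 1 - c * p + K * (p * t) := by
    refine ContinuousLinearMap.opNorm_le_of_unit_norm (𝕜 := ℂ) ?_ fun x hx => ?_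
    · have : c * p ≤ C₀ * t := mul_le_mul (by linarith) hple hp0 hC₀0
      have : 0 ≤ K * (p * t) := by positivity
      linarith
    · have h1 := hK x t hx ht ht1'
      rw [hpt, ← hp] at h1
      have h2 := norm_sq_semigroup hbd x t
      rw [hx] at h2
      -- Upper half of the square root: `2u ≤ 1 + u²`.
      nlinarith [sq_nonneg (‖semigroup b t x‖ - 1)]
  have hlower : 1 - c * p - (C₁ + 2 * C₀ ^ 2) * (p * t) ≤ ‖semigroup b t‖ := by
    obtain ⟨x, hxx, hxd⟩ := hQ t ht ht1'
    rw [hpt, ← hp] at hxd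
    set y := ‖semigroup b t‖ with hy
    have hy0 : 0 ≤ y := norm_nonneg _
    have h1 := norm_sq_semigroup hbd x t
    have h2 : ‖semigroup b t x‖ ^ 2 ≤ y ^ 2 * ‖x‖ ^ 2 := by
      rw [← mul_pow]
      exact pow_le_pow_left₀ (norm_nonneg _) ((semigroup b t).le_opNorm x) 2
    have h3 : 1 - Q * t ≤ ‖x‖ := by
      have := norm_sub_norm_le x₀ x
      rw [norm_sub_rev] at this
      linarith
    have h5 : 0 ≤ Q * t := by positivity
    set h := c * p + Q * (p * t) with hh
    have hh0 : 0 ≤ h := by positivity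
    set H := h * (1 + 4 * (Q * t)) with hH
    have hH0 : 0 ≤ H := by positivity
    have hHle : H ≤ c * p + C₁ * (p * t) := by
      have : H = c * p + (Q + 4 * Q * c) * (p * t) + 4 * Q ^ 2 * (p * t) * t := by
        rw [hH, hh]; ring
      have h8 : 4 * Q ^ 2 * (p * t) * t ≤ 4 * Q ^ 2 * (p * t) :=
        mul_le_of_le_one_right (by positivity) ht1'
      rw [this, hC₁]; linarith
    have hHp : H ≤ C₀ * p := by
      have : C₁ * (p * t) ≤ C₁ * p := by
        rw [← mul_assoc]; exact mul_le_of_le_one_right (by positivity) ht1'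
      rw [hC₀]; linarith
    have hHhalf : H ≤ 1 / 2 := by
      have : C₀ * p ≤ C₀ * t := mul_le_mul_of_nonneg_left hple hC₀0
      linarith
    have hH2 : H ^ 2 ≤ C₀ ^ 2 * (p * t) := by
      have h8 : H ^ 2 ≤ (C₀ * p) ^ 2 := pow_le_pow_left₀ hH0 hHp 2
      have h9 : C₀ ^ 2 * (p * p) ≤ C₀ ^ 2 * (p * t) := by gcongr
      linarith
    have hroot : 1 - H - 2 * H ^ 2 ≤ y :=
      le_of_sq_mul_sq_ge hy0 h5 hQt h3 hh0 hHhalf (by linarith)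
    linarith
  have hpt0 : 0 ≤ p * t := by positivity
  rw [abs_le]
  constructor
  · have := mul_le_mul_of_nonneg_right (le_max_right K (C₁ + 2 * C₀ ^ 2)) hpt0
    linarith
  · have := mul_le_mul_of_nonneg_right (le_max_left K (C₁ + 2 * C₀ ^ 2)) hpt0
    linarith

end Dissipation

/-! ### Uniqueness of the exponent and the coefficient -/

open Filter Topology in
theorem leadingCoeff_eq_zero_of_lt {a a' c c' M M' δ : ℝ} (hδ : 0 < δ) (haa : a < a')
    (h : ∀ t : ℝ, 0 < t → t < δ → |c * t ^ a - c' * t ^ a'| ≤ M * t ^ (a + 1) + M' * t ^ (a' + 1)) :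
    c = 0 := by
  have hlim : Tendsto (fun t : ℝ => |c'| * t ^ (a' - a) + M * t + M' * (t ^ (a' - a) * t))
      (𝓝[>] 0) (𝓝 0) := by
    have h1 : ContinuousAt (fun t : ℝ => t ^ (a' - a)) 0 :=
      Real.continuousAt_rpow_const _ _ (Or.inr (by linarith))
    have h2 : ContinuousAt (fun t : ℝ => |c'| * t ^ (a' - a) + M * t + M' * (t ^ (a' - a) * t)) 0 := by
      fun_prop
    have h3 := h2.tendsto
    simp only [Real.zero_rpow (sub_pos.2 haa).ne', mul_zero, add_zero] at h3
    exact h3.mono_left nhdsWithin_le_nhds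
  have hle : |c| ≤ 0 := by
    refine ge_of_tendsto hlim ?_
    filter_upwards [Ioo_mem_nhdsGT hδ] with t ht
    have ht0 := ht.1
    have h1 := h t ht.1 ht.2
    have e1 : t ^ a' = t ^ a * t ^ (a' - a) := by rw [← Real.rpow_add ht0]; congr 1; ring
    rw [Real.rpow_add ht0, Real.rpow_add ht0, Real.rpow_one, e1] at h1
    have hp := Real.rpow_pos_of_pos ht0 a
    have hq := Real.rpow_pos_of_pos ht0 (a' - a)
    have h2 : |c * t ^ a| - |c' * (t ^ a * t ^ (a' - a))| ≤ _ := (abs_sub_abs_le_abs_sub _ _).trans h1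
    rw [abs_mul, abs_mul, abs_of_pos hp, abs_of_pos (mul_pos hp hq)] at h2
    refine le_of_mul_le_mul_left (a := t ^ a) ?_ hp
    linarith
  exact abs_eq_zero.1 (le_antisymm hle (abs_nonneg _))

theorem leadingCoeff_eq {a c c' M δ : ℝ} (hδ : 0 < δ)
    (h : ∀ t : ℝ, 0 < t → t < δ → |c * t ^ a - c' * t ^ a| ≤ M * t ^ (a + 1)) : c = c' := by
  -- Equal exponents become a case of distinct ones by adding a zero term of exponent `a + 1`.
  have h0 := leadingCoeff_eq_zero_of_lt (a := a) (a' := a + 1) (c := c - c') (c' := 0) (M := M)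
    (M' := 0) hδ (by linarith) fun t ht htδ => by
      have := h t ht htδ
      rwa [zero_mul, sub_zero, zero_mul, add_zero, sub_mul]
  linarith

theorem HasShortTimeDecay.unique {n : ℕ} {B : Matrix (Fin n) (Fin n) ℂ} {a a' c c' : ℝ}
    (h : HasShortTimeDecay B a c) (h' : HasShortTimeDecay B a' c') (hc : c ≠ 0) (hc' : c' ≠ 0) :
    a = a' ∧ c = c' := by
  obtain ⟨δ, hδ, M, hM⟩ := h
  obtain ⟨δ', hδ', M', hM'⟩ := h'
  have key : ∀ t : ℝ, 0 < t → t < min δ δ' →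
      |c * t ^ a - c' * t ^ a'| ≤ M * t ^ (a + 1) + M' * t ^ (a' + 1) := by
    intro t ht htδ
    have h1 := hM t ht.le (htδ.trans_le (min_le_left _ _))
    have h2 := hM' t ht.le (htδ.trans_le (min_le_right _ _))
    rw [abs_le] at *
    constructor <;> linarith [h1.1, h1.2, h2.1, h2.2]
  have hδδ : 0 < min δ δ' := lt_min hδ hδ'
  rcases lt_trichotomy a a' with hlt | heq | hlt
  · exact absurd (leadingCoeff_eq_zero_of_lt hδδ hlt key) hc
  · subst heq
    refine ⟨rfl, leadingCoeff_eq (a := a) (M := M + M') hδδ fun t ht htδ => ?_⟩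
    rw [add_mul]; exact key t ht htδ
  · refine absurd (leadingCoeff_eq_zero_of_lt (c' := c) (M := M') (M' := M) hδδ hlt fun t ht htδ => ?_) hc'
    rw [abs_sub_comm, add_comm]; exact key t ht htδ

/-! ### Joint kernels of the observables and their independence of `ε` -/

section JointKernel

variable {E : Type*} [NormedAddCommGroup E] [InnerProductSpace ℂ E]

/-- The term `e * d` drops out whenever `d` kills the current iterate. The disjunctive hypothesis
serves both directions of `joint_kernel_iff`. -/
theorem pow_apply_eq_of_dissipation_zero {a b d e : E →L[ℂ] E} {ε : ℂ}
    (hb : b = ε • a + e * d) {m : ℕ} {x : E}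
    (h : ∀ j < m, d ((b ^ j) x) = 0 ∨ d ((a ^ j) x) = 0) :
    ∀ j ≤ m, (b ^ j) x = ε ^ j • (a ^ j) x := by
  intro j
  induction j with
  | zero => intro _; simp
  | succ j ih =>
    intro hj
    have h1 := ih (by omega)
    have h2 : d ((b ^ j) x) = 0 := by
      rcases h j (by omega) with h2 | h2
      · exact h2
      · rw [h1, map_smul, h2, smul_zero]
    have h3 : b ((b ^ j) x) = ε • a ((b ^ j) x) + e (d ((b ^ j) x)) := by
      exact (congrArg (fun f : E →L[ℂ] E => f ((b ^ j) x)) hb).trans rfl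
    rw [pow_succ', mul_apply_eq_comp, h3, h2, map_zero, add_zero, h1, map_smul,
      smul_smul, ← pow_succ', pow_succ' a, mul_apply_eq_comp]

theorem joint_kernel_iff {a b d e : E →L[ℂ] E} {ε : ℂ} (hε : ε ≠ 0) (hb : b = ε • a + e * d)
    (m : ℕ) (x : E) : (∀ j < m, d ((b ^ j) x) = 0) ↔ ∀ j < m, d ((a ^ j) x) = 0 := by
  constructor
  · intro h j hj
    have h1 := h j hj
    rw [pow_apply_eq_of_dissipation_zero hb (fun j hj => Or.inl (h j hj)) j hj.le, map_smul] at h1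
    exact (smul_eq_zero.1 h1).resolve_left (pow_ne_zero _ hε)
  · intro h j hj
    rw [pow_apply_eq_of_dissipation_zero hb (fun j hj => Or.inr (h j hj)) j hj.le, map_smul, h j hj,
      smul_zero]

/-- If every eigenvalue of `b` has positive real part, finitely many of the observables
`x ↦ d (b ^ j x)` separate the points. -/
theorem exists_joint_kernel_trivial [FiniteDimensional ℂ E] {b d : E →L[ℂ] E}
    (hbd : ∀ x, (inner ℂ x (b x)).re = ‖d x‖ ^ 2)
    (heig : ∀ (z : ℂ) (v : E), v ≠ 0 → b v = z • v → 0 < z.re) :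
    ∃ k : ℕ, ∀ x, (∀ j < k, d ((b ^ j) x) = 0) → x = 0 := by
  set W : ℕ → Submodule ℂ E := fun k =>
    ⨅ j ∈ Finset.range k, LinearMap.ker ((d ∘L (b ^ j) : E →L[ℂ] E) : E →ₗ[ℂ] E) with hW
  have hmem : ∀ k x, x ∈ W k ↔ ∀ j < k, d ((b ^ j) x) = 0 := by
    intro k x
    simp only [hW, Submodule.mem_iInf, Finset.mem_range]
    rfl
  have hanti : ∀ i j, i ≤ j → W j ≤ W i := by
    intro i j hij x hx
    rw [hmem] at *
    exact fun r hr => hx r (hr.trans_le hij)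
  obtain ⟨k, hk⟩ := IsArtinian.monotone_stabilizes
    (⟨fun i => OrderDual.toDual (W i), fun i j hij => hanti i j hij⟩ : ℕ →o (Submodule ℂ E)ᵒᵈ)
  have hk' : ∀ i, k ≤ i → W k = W i := fun i hi => hk i hi
  refine ⟨k, fun x hx => ?_⟩
  by_contra hx0
  -- Once the chain is stationary, `W k = W (k + 1)` is `b`-invariant. If nonzero, it contains an
  -- eigenvector `v` with `d v = 0`, whose eigenvalue has real part zero by `hbd`.
  have hinv : ∀ y ∈ W k, (b : E →ₗ[ℂ] E) y ∈ W k := by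
    intro y hy
    rw [hk' (k + 1) (by omega), hmem] at hy
    rw [hmem]
    intro j hj
    have := hy (j + 1) (by omega)
    rwa [pow_succ] at this
  have hnt : Nontrivial (W k) := ⟨⟨⟨x, (hmem k x).2 hx⟩, 0, fun h => hx0 (congrArg Subtype.val h)⟩⟩
  obtain ⟨z, hz⟩ := Module.End.exists_eigenvalue ((b : E →ₗ[ℂ] E).restrict hinv)
  obtain ⟨v, hv⟩ := hz.exists_hasEigenvector
  have hbv : b (v : E) = z • (v : E) := congrArg Subtype.val hv.apply_eq_smul
  have hv0 : (v : E) ≠ 0 := fun h => hv.2 (Subtype.ext h)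
  have hz0 := heig z v hv0 hbv
  have hdv : d (v : E) = 0 := by
    have h1 : (v : E) ∈ W (k + 1) := (hk' (k + 1) (by omega)).le v.2
    exact (hmem _ _).1 h1 0 (by omega)
  have h2 := hbd v
  rw [hdv, hbv, inner_smul_right, inner_self_eq_norm_sq_to_K] at h2
  have h3 : 0 < ‖(v : E)‖ ^ 2 := by positivity
  have h4 : (z * ((‖(v : E)‖ : ℂ)) ^ 2).re = z.re * ‖(v : E)‖ ^ 2 := by
    rw [← Complex.ofReal_pow, Complex.re_mul_ofReal]
  have h5 : z.re * ‖(v : E)‖ ^ 2 = 0 := by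
    rw [← h4]; simpa using h2
  exact (mul_pos hz0 h3).ne' h5

/-- A continuous linear map attains its minimal gain on a nontrivial joint kernel. -/
theorem exists_min_on_joint_kernel [FiniteDimensional ℂ E] (T : ℕ → E →L[ℂ] E) (m : ℕ) {x : E}
    (hx : x ≠ 0) (hker : ∀ j < m, T j x = 0) :
    ∃ x₀ : E, ‖x₀‖ = 1 ∧ (∀ j < m, T j x₀ = 0) ∧
      ∀ y, (∀ j < m, T j y = 0) → ‖T m x₀‖ * ‖y‖ ≤ ‖T m y‖ := by
  have : ProperSpace E := FiniteDimensional.proper ℂ E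
  have hnormalize : ∀ y : E, y ≠ 0 → (∀ j < m, T j y = 0) →
      ((‖y‖ : ℂ)⁻¹ • y) ∈ Metric.sphere (0 : E) 1 ∩ ⋂ j ∈ Finset.range m, {x | T j x = 0} := by
    intro y hy h
    constructor
    · rw [mem_sphere_zero_iff_norm, norm_smul, norm_inv, Complex.norm_real, norm_norm]
      exact inv_mul_cancel₀ (norm_ne_zero_iff.2 hy)
    · simp only [Set.mem_iInter, Finset.mem_range, Set.mem_ofPred_eq]
      intro j hj
      rw [map_smul, h j hj, smul_zero]
  have hcomp : IsCompact (Metric.sphere (0 : E) 1 ∩ ⋂ j ∈ Finset.range m, {x | T j x = 0}) :=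
    (isCompact_sphere 0 1).inter_right <| isClosed_biInter fun j _ =>
      isClosed_eq (T j).continuous continuous_const
  obtain ⟨x₀, hx₀, hmin⟩ := hcomp.exists_isMinOn ⟨_, hnormalize x hx hker⟩
    (T m).continuous.norm.continuousOn
  refine ⟨x₀, mem_sphere_zero_iff_norm.1 hx₀.1, ?_, fun y hy => ?_⟩
  · have := hx₀.2
    simp only [Set.mem_iInter, Finset.mem_range, Set.mem_ofPred_eq] at this
    exact this
  · rcases eq_or_ne y 0 with rfl | hy0
    · simp
    · have h1 : ‖T m x₀‖ ≤ ‖T m ((‖y‖ : ℂ)⁻¹ • y)‖ := hmin (hnormalize y hy0 hy)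
      rw [map_smul, norm_smul, norm_inv, Complex.norm_real, norm_norm] at h1
      have h2 : 0 < ‖y‖ := norm_pos_iff.2 hy0
      rwa [← div_eq_inv_mul, le_div_iff₀ h2] at h1

theorem exists_min_observable [FiniteDimensional ℂ E] (a d : E →L[ℂ] E) (m : ℕ) {x : E}
    (hx : x ≠ 0) (hker : ∀ j < m, d ((a ^ j) x) = 0) :
    ∃ x₀ : E, ‖x₀‖ = 1 ∧ (∀ j < m, d ((a ^ j) x₀) = 0) ∧
      ∀ y, (∀ j < m, d ((a ^ j) y) = 0) → ‖d ((a ^ m) x₀)‖ * ‖y‖ ≤ ‖d ((a ^ m) y)‖ :=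
  exists_min_on_joint_kernel (fun j => d ∘L (a ^ j)) m hx hker

end JointKernel

/-! ### From matrices to operators on Euclidean space -/

open Matrix

variable {n : ℕ}

/-- The action of a square matrix on Euclidean space. -/
noncomputable abbrev toOp (M : Matrix (Fin n) (Fin n) ℂ) :
    EuclideanSpace ℂ (Fin n) →L[ℂ] EuclideanSpace ℂ (Fin n) :=
  Matrix.toEuclideanCLM (n := Fin n) (𝕜 := ℂ) M

open scoped Matrix.Norms.Operator in
theorem toOp_exp (M : Matrix (Fin n) (Fin n) ℂ) :
    toOp (NormedSpace.exp M) = NormedSpace.exp (toOp M) := by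
  have : Continuous (Matrix.toEuclideanCLM (n := Fin n) (𝕜 := ℂ)) :=
    (Matrix.toEuclideanCLM (n := Fin n) (𝕜 := ℂ)).toAlgEquiv.toLinearMap.continuous_of_finiteDimensional
  exact NormedSpace.map_exp (Matrix.toEuclideanCLM (n := Fin n) (𝕜 := ℂ)) this M

theorem propagatorNorm_eq (B : Matrix (Fin n) (Fin n) ℂ) (t : ℝ) :
    propagatorNorm B t = ‖semigroup (toOp B) t‖ := by
  rw [propagatorNorm, semigroup]
  change ‖toOp _‖ = _
  rw [toOp_exp]
  simp only [toOp, map_neg, map_smul]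

theorem inner_toOp_conjTranspose_mul_self (M : Matrix (Fin n) (Fin n) ℂ)
    (x : EuclideanSpace ℂ (Fin n)) :
    inner ℂ x (toOp (Mᴴ * M) x) = ((‖toOp M x‖ ^ 2 : ℝ) : ℂ) := by
  have h : toOp (Mᴴ * M) = ContinuousLinearMap.adjoint (toOp M) * toOp M := by
    simp only [toOp]
    rw [map_mul, ← star_eq_conjTranspose, map_star]
    rfl
  rw [h, mul_apply_eq_comp, ContinuousLinearMap.adjoint_inner_right, inner_self_eq_norm_sq_to_K]
  push_cast; rfl

open scoped MatrixOrder in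
theorem exists_eq_conjTranspose_mul_self {C : Matrix (Fin n) (Fin n) ℂ} (hC : C.PosSemidef) :
    ∃ D : Matrix (Fin n) (Fin n) ℂ, C = Dᴴ * D := by
  refine ⟨CFC.sqrt C, ?_⟩
  have h : (CFC.sqrt C)ᴴ = CFC.sqrt C :=
    (Matrix.nonneg_iff_posSemidef.1 (CFC.sqrt_nonneg C)).isHermitian
  rw [h, CFC.sqrt_mul_sqrt_self C hC.nonneg]

theorem star_dotProduct_mulVec_eq_inner (M : Matrix (Fin n) (Fin n) ℂ) (x : Fin n → ℂ) :
    star x ⬝ᵥ (M *ᵥ x) = inner ℂ (WithLp.toLp 2 x) (toOp M (WithLp.toLp 2 x)) := by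
  rw [EuclideanSpace.inner_eq_star_dotProduct, dotProduct_comm]
  rfl

theorem inner_toOp_sum (M : ℕ → Matrix (Fin n) (Fin n) ℂ) (k : ℕ) (x : EuclideanSpace ℂ (Fin n)) :
    inner ℂ x (toOp (∑ j ∈ Finset.range k, (M j)ᴴ * M j) x) =
      ((∑ j ∈ Finset.range k, ‖toOp (M j) x‖ ^ 2 : ℝ) : ℂ) := by
  have h : toOp (∑ j ∈ Finset.range k, (M j)ᴴ * M j) =
      ∑ j ∈ Finset.range k, toOp ((M j)ᴴ * M j) := map_sum _ _ _
  rw [h, _root_.sum_apply, inner_sum, Complex.ofReal_sum]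
  exact Finset.sum_congr rfl fun j _ => inner_toOp_conjTranspose_mul_self _ _

theorem sum_norm_sq_eq_zero_iff (M : ℕ → Matrix (Fin n) (Fin n) ℂ) (k : ℕ)
    (x : EuclideanSpace ℂ (Fin n)) :
    ∑ j ∈ Finset.range k, ‖toOp (M j) x‖ ^ 2 = 0 ↔ ∀ j < k, toOp (M j) x = 0 := by
  rw [Finset.sum_eq_zero_iff_of_nonneg fun _ _ => sq_nonneg _]
  simp only [Finset.mem_range, sq_eq_zero_iff, norm_eq_zero]

/-- Pairing a sum of Gram matrices with `x` gives a sum of squares, which vanishes only termwise. -/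
theorem mem_ker_sum_iff (M : ℕ → Matrix (Fin n) (Fin n) ℂ) (k : ℕ)
    (x : EuclideanSpace ℂ (Fin n)) :
    toOp (∑ j ∈ Finset.range k, (M j)ᴴ * M j) x = 0 ↔ ∀ j < k, toOp (M j) x = 0 := by
  constructor
  · intro h
    rw [← sum_norm_sq_eq_zero_iff]
    have h1 := inner_toOp_sum M k x
    rw [h, inner_zero_right] at h1
    exact_mod_cast h1.symm
  · intro h
    have h1 : toOp (∑ j ∈ Finset.range k, (M j)ᴴ * M j) =
        ∑ j ∈ Finset.range k, toOp ((M j)ᴴ * M j) := map_sum _ _ _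
    rw [h1, _root_.sum_apply]
    refine Finset.sum_eq_zero fun j hj => ?_
    have h2 : toOp ((M j)ᴴ * M j) = toOp (M j)ᴴ * toOp (M j) := map_mul _ _ _
    rw [h2, mul_apply_eq_comp, h j (Finset.mem_range.1 hj), map_zero]

theorem posDef_sum_iff (M : ℕ → Matrix (Fin n) (Fin n) ℂ) (k : ℕ) :
    (∑ j ∈ Finset.range k, (M j)ᴴ * M j).PosDef ↔
      ∀ x, (∀ j < k, toOp (M j) x = 0) → x = 0 := by
  have hinner : ∀ x : Fin n → ℂ, star x ⬝ᵥ ((∑ j ∈ Finset.range k, (M j)ᴴ * M j) *ᵥ x) =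
      ((∑ j ∈ Finset.range k, ‖toOp (M j) (WithLp.toLp 2 x)‖ ^ 2 : ℝ) : ℂ) := fun x => by
    rw [star_dotProduct_mulVec_eq_inner, inner_toOp_sum]
  rw [posDef_iff_dotProduct_mulVec]
  constructor
  · rintro ⟨-, h⟩ x hx
    by_contra hx0
    have h1 := h (x := WithLp.ofLp x) fun h => hx0 (by ext i; exact congrFun h i)
    rw [hinner, WithLp.toLp_ofLp, (sum_norm_sq_eq_zero_iff M k x).2 hx] at h1
    simp at h1
  · intro h
    refine ⟨?_, fun x hx => ?_⟩
    · rw [IsHermitian, conjTranspose_sum]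
      exact Finset.sum_congr rfl fun j _ => isHermitian_conjTranspose_mul_self _
    · rw [hinner, Complex.zero_lt_real]
      refine lt_of_le_of_ne (Finset.sum_nonneg fun _ _ => sq_nonneg _) fun h0 => hx ?_
      have h1 := h _ ((sum_norm_sq_eq_zero_iff M k _).1 h0.symm)
      exact congrArg WithLp.ofLp h1

/-! ### The family `ε A + D* D` -/

section Family

variable {A D : Matrix (Fin n) (Fin n) ℂ}

theorem conjTranspose_family (hA : Aᴴ = -A) (ε : ℝ) :
    ((ε : ℂ) • A + Dᴴ * D)ᴴ = -((ε : ℂ) • A) + Dᴴ * D := by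
  rw [conjTranspose_add, conjTranspose_smul, hA, isHermitian_conjTranspose_mul_self D]
  simp

theorem hermPart_family (hA : Aᴴ = -A) (ε : ℝ) :
    hermPart ((ε : ℂ) • A + Dᴴ * D) = Dᴴ * D := by
  rw [hermPart, conjTranspose_family hA]
  have : (ε : ℂ) • A + Dᴴ * D + (-((ε : ℂ) • A) + Dᴴ * D) = (2 : ℂ) • (Dᴴ * D) := by
    rw [two_smul]; abel
  rw [this, smul_smul]; norm_num

theorem antiHermPart_family (hA : Aᴴ = -A) (ε : ℝ) :
    antiHermPart ((ε : ℂ) • A + Dᴴ * D) = (ε : ℂ) • A := by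
  rw [antiHermPart, conjTranspose_family hA]
  have : (ε : ℂ) • A + Dᴴ * D - (-((ε : ℂ) • A) + Dᴴ * D) = (2 : ℂ) • ((ε : ℂ) • A) := by
    rw [two_smul]; abel
  rw [this, smul_smul]; norm_num

theorem toOp_mul_pow_apply (D A : Matrix (Fin n) (Fin n) ℂ) (j : ℕ)
    (x : EuclideanSpace ℂ (Fin n)) : toOp (D * A ^ j) x = toOp D ((toOp A ^ j) x) := by
  have h : toOp (D * A ^ j) = toOp D * toOp A ^ j := by simp only [toOp, map_mul, map_pow]
  rw [h]; rfl

/-- Each summand is the Gram matrix of `(-ε)^j D A^j`, and the nonzero scalar does not affect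
kernels. -/
theorem posDef_T_iff (hA : Aᴴ = -A) {ε : ℝ} (hε : ε ≠ 0) (m : ℕ) :
    (T ((ε : ℂ) • A + Dᴴ * D) m).PosDef ↔
      ∀ x, (∀ j < m + 1, toOp D ((toOp A ^ j) x) = 0) → x = 0 := by
  have h : T ((ε : ℂ) • A + Dᴴ * D) m =
      ∑ j ∈ Finset.range (m + 1), (D * ((-ε : ℂ) ^ j • A ^ j))ᴴ * (D * ((-ε : ℂ) ^ j • A ^ j)) := by
    rw [T, hermPart_family hA, antiHermPart_family hA]
    have h1 : ((ε : ℂ) • A)ᴴ = (-ε : ℂ) • A := by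
      rw [conjTranspose_smul, hA]; simp
    have h2 : ((-ε : ℂ) • A)ᴴ = (ε : ℂ) • A := by
      rw [conjTranspose_smul, hA]; simp
    refine Finset.sum_congr rfl fun j _ => ?_
    rw [h1, ← smul_pow, conjTranspose_mul, conjTranspose_pow, h2]
    simp only [Matrix.mul_assoc]
  have h3 : ∀ (j : ℕ) (x : EuclideanSpace ℂ (Fin n)), toOp (D * ((-ε : ℂ) ^ j • A ^ j)) x = 0 ↔
      toOp D ((toOp A ^ j) x) = 0 := by
    intro j x
    have h4 : toOp (D * ((-ε : ℂ) ^ j • A ^ j)) x = (-ε : ℂ) ^ j • toOp (D * A ^ j) x := by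
      rw [Matrix.mul_smul]; simp only [toOp, map_smul]; rfl
    have h5 : (-ε : ℂ) ^ j ≠ 0 := pow_ne_zero _ (neg_ne_zero.2 (by exact_mod_cast hε))
    rw [h4, smul_eq_zero_iff_right h5, toOp_mul_pow_apply]
  rw [h, posDef_sum_iff]
  simp only [h3]

/-- Here the powers are those of the full matrix; `joint_kernel_iff` later replaces them by powers
of `A`. -/
theorem mem_ker_TTildePred_iff (hA : Aᴴ = -A) (ε : ℝ) (m : ℕ) (x : EuclideanSpace ℂ (Fin n)) :
    x ∈ LinearMap.ker (Matrix.toEuclideanLin (TTildePred ((ε : ℂ) • A + Dᴴ * D) m)) ↔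
      ∀ j < m, toOp D ((toOp ((ε : ℂ) • A + Dᴴ * D) ^ j) x) = 0 := by
  set B := (ε : ℂ) • A + Dᴴ * D with hB
  have h : TTildePred B m = ∑ j ∈ Finset.range m, (D * B ^ j)ᴴ * (D * B ^ j) := by
    rw [TTildePred, hB, hermPart_family hA]
    refine Finset.sum_congr rfl fun j _ => ?_
    rw [conjTranspose_mul, conjTranspose_pow]
    simp only [Matrix.mul_assoc]
  rw [LinearMap.mem_ker, h]
  refine (mem_ker_sum_iff (fun j => D * B ^ j) m x).trans ?_
  simp only [toOp_mul_pow_apply]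

theorem toOp_family (A D : Matrix (Fin n) (Fin n) ℂ) (ε : ℝ) :
    toOp ((ε : ℂ) • A + Dᴴ * D) = (ε : ℂ) • toOp A + toOp Dᴴ * toOp D := by
  simp only [toOp, map_add, map_smul, map_mul]

theorem re_inner_toOp_family (hA : Aᴴ = -A) (ε : ℝ) (x : EuclideanSpace ℂ (Fin n)) :
    (inner ℂ x (toOp ((ε : ℂ) • A + Dᴴ * D) x)).re = ‖toOp D x‖ ^ 2 := by
  have h1 : toOp ((ε : ℂ) • A + Dᴴ * D) = (ε : ℂ) • toOp A + toOp (Dᴴ * D) := by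
    simp only [toOp, map_add, map_smul]
  have h2 : ContinuousLinearMap.adjoint (toOp A) = -toOp A := by
    have : ContinuousLinearMap.adjoint (toOp A) = toOp Aᴴ := by
      rw [← star_eq_conjTranspose]; simp only [toOp]; rw [map_star]; rfl
    rw [this, hA]; simp only [toOp, map_neg]
  have h3 : (inner ℂ x (toOp A x)).re = 0 := by
    have h4 := ContinuousLinearMap.adjoint_inner_right (toOp A) x x
    rw [h2, _root_.neg_apply, inner_neg_right, ← inner_conj_symm (toOp A x) x] at h4
    have h5 := congrArg Complex.re h4
    rw [Complex.neg_re, Complex.conj_re] at h5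
    linarith
  rw [h1, _root_.add_apply, inner_add_right, inner_toOp_conjTranspose_mul_self, _root_.smul_apply,
    inner_smul_right, Complex.add_re, Complex.re_ofReal_mul, h3, mul_zero, zero_add,
    Complex.ofReal_re]

theorem re_pos_of_isHypocoercive {B : Matrix (Fin n) (Fin n) ℂ} (hB : IsHypocoercive B) (z : ℂ)
    (v : EuclideanSpace ℂ (Fin n)) (hv : v ≠ 0) (h : toOp B v = z • v) : 0 < z.re := by
  refine hB z ?_
  rw [← Matrix.spectrum_toLpLin 2]
  refine Module.End.HasEigenvalue.mem_spectrum
    (Module.End.hasEigenvalue_of_hasEigenvector (x := v) ⟨?_, hv⟩)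
  rw [Module.End.mem_eigenspace_iff]
  exact h

theorem decayCoeff_eq (ε : ℝ) (m : ℕ) (μ : ℝ) :
    decayCoeff ε m μ = decayFactor m * (ε ^ (2 * m) * μ) := by
  rw [decayCoeff, decayFactor]; ring

theorem hasShortTimeDecay_family (hA : Aᴴ = -A) {ε : ℝ} (hε : ε ≠ 0) (m : ℕ)
    {x₀ : EuclideanSpace ℂ (Fin n)} (hx₀ : ‖x₀‖ = 1)
    (hker : ∀ j < m, toOp D ((toOp A ^ j) x₀) = 0)
    (hmin : ∀ y, (∀ j < m, toOp D ((toOp A ^ j) y) = 0) →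
      ‖toOp D ((toOp A ^ m) x₀)‖ * ‖y‖ ≤ ‖toOp D ((toOp A ^ m) y)‖) :
    HasShortTimeDecay ((ε : ℂ) • A + Dᴴ * D) (2 * (m : ℝ) + 1)
      (decayCoeff ε m (‖toOp D ((toOp A ^ m) x₀)‖ ^ 2)) := by
  have hε' : (ε : ℂ) ≠ 0 := by exact_mod_cast hε
  have hb := toOp_family A D ε
  have hiff := fun y => joint_kernel_iff hε' hb m y
  have hnorm : ∀ y, (∀ j < m, toOp D ((toOp A ^ j) y) = 0) →
      ‖toOp D ((toOp ((ε : ℂ) • A + Dᴴ * D) ^ m) y)‖ = |ε| ^ m * ‖toOp D ((toOp A ^ m) y)‖ := by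
    intro y hy
    rw [pow_apply_eq_of_dissipation_zero hb (fun j hj => Or.inr (hy j hj)) m le_rfl, map_smul,
      norm_smul, norm_pow, Complex.norm_real, Real.norm_eq_abs]
  obtain ⟨δ, hδ, M, hM⟩ := exists_norm_semigroup_expansion (re_inner_toOp_family (D := D) hA ε) m
    hx₀ ((hiff x₀).2 hker) fun y hy => by
      have hy' := (hiff y).1 hy
      rw [hnorm x₀ hker, hnorm y hy', mul_assoc]
      exact mul_le_mul_of_nonneg_left (hmin y hy') (by positivity)
  refine ⟨δ, hδ, M, fun t ht htδ => ?_⟩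
  have h := hM t ht htδ
  have e1 : t ^ (2 * (m : ℝ) + 1) = t ^ (2 * m + 1) := by
    rw [← Real.rpow_natCast]; push_cast; rfl
  have e2 : t ^ (2 * (m : ℝ) + 1 + 1) = t ^ (2 * m + 2) := by
    rw [← Real.rpow_natCast]; push_cast; congr 1; ring
  have e3 : (|ε| ^ m * ‖toOp D ((toOp A ^ m) x₀)‖) ^ 2 =
      ε ^ (2 * m) * ‖toOp D ((toOp A ^ m) x₀)‖ ^ 2 := by
    rw [mul_pow, ← pow_mul, mul_comm m 2, pow_mul |ε|, sq_abs, ← pow_mul]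
  rw [hnorm x₀ hker, e3, ← decayCoeff_eq] at h
  rw [e1, e2, propagatorNorm_eq]
  exact h

theorem isLeast_kernelValues_family (hA : Aᴴ = -A) {ε : ℝ} (hε : ε ≠ 0) (m : ℕ)
    {x₀ : EuclideanSpace ℂ (Fin n)} (hx₀ : ‖x₀‖ = 1)
    (hker : ∀ j < m, toOp D ((toOp A ^ j) x₀) = 0)
    (hmin : ∀ y, (∀ j < m, toOp D ((toOp A ^ j) y) = 0) →
      ‖toOp D ((toOp A ^ m) x₀)‖ * ‖y‖ ≤ ‖toOp D ((toOp A ^ m) y)‖) :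
    IsLeast (kernelValues ((ε : ℂ) • A + Dᴴ * D) A (Dᴴ * D) m)
      (‖toOp D ((toOp A ^ m) x₀)‖ ^ 2) := by
  have hε' : (ε : ℂ) ≠ 0 := by exact_mod_cast hε
  have hiff := fun y => (mem_ker_TTildePred_iff (D := D) hA ε m y).trans
    (joint_kernel_iff hε' (toOp_family A D ε) m y)
  have hval : ∀ y : EuclideanSpace ℂ (Fin n),
      (inner ℂ y (Matrix.toEuclideanLin (Aᴴ ^ m * (Dᴴ * D) * A ^ m) y)).re =
        ‖toOp D ((toOp A ^ m) y)‖ ^ 2 := by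
    intro y
    have h1 : Aᴴ ^ m * (Dᴴ * D) * A ^ m = (D * A ^ m)ᴴ * (D * A ^ m) := by
      rw [conjTranspose_mul, conjTranspose_pow]
      simp only [Matrix.mul_assoc]
    rw [h1, ← toOp_mul_pow_apply]
    exact congrArg Complex.re (inner_toOp_conjTranspose_mul_self (D * A ^ m) y)
  constructor
  · exact ⟨x₀, (hiff x₀).2 hker, hx₀, (hval x₀).symm⟩
  · rintro r ⟨y, hy, hy1, rfl⟩
    rw [hval]
    have h := hmin y ((hiff y).1 hy)
    rw [hy1, mul_one] at h
    exact pow_le_pow_left₀ (norm_nonneg _) h 2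

theorem hcIndex_family (hA : Aᴴ = -A) {ε : ℝ} (hε : ε ≠ 0) {m : ℕ}
    (hm : ∀ x, (∀ j < m + 1, toOp D ((toOp A ^ j) x) = 0) → x = 0)
    {x₀ : EuclideanSpace ℂ (Fin n)} (hx₀ : x₀ ≠ 0)
    (hker : ∀ j < m, toOp D ((toOp A ^ j) x₀) = 0) :
    hcIndex ((ε : ℂ) • A + Dᴴ * D) = (m : ℕ∞) := by
  refine IsLeast.csInf_eq ⟨⟨m, rfl, (posDef_T_iff hA hε m).2 hm⟩, ?_⟩
  rintro k ⟨m', rfl, hpos⟩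
  have h := (posDef_T_iff hA hε m').1 hpos
  by_contra! hlt
  have hlt' : m' < m := by exact_mod_cast hlt
  exact hx₀ (h x₀ fun j hj => hker j (by omega))

end Family

end ShortTimeDecay

/-! ### The main theorem -/

open ShortTimeDecay in
theorem mainTheorem2 (n : ℕ) (hn : 1 ≤ n) (A C : Matrix (Fin n) (Fin n) ℂ)
    (hA : A.conjTranspose = -A) (hC : C.PosSemidef)
    (hHC : ∃ ε₀ : ℝ, ε₀ ≠ 0 ∧ ShortTimeDecay.IsHypocoercive ((ε₀ : ℂ) • A + C)) :
    ∃ (m : ℕ) (μ : ℝ), 0 < μ ∧ ∀ ε : ℝ, ε ≠ 0 →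
      ShortTimeDecay.hcIndex ((ε : ℂ) • A + C) = (m : ℕ∞) ∧
      IsLeast (ShortTimeDecay.kernelValues ((ε : ℂ) • A + C) A C m) μ ∧
      ShortTimeDecay.HasShortTimeDecay ((ε : ℂ) • A + C) (2 * (m : ℝ) + 1)
        (ShortTimeDecay.decayCoeff ε m μ) ∧
      ∀ a c : ℝ, 0 < a → 0 < c → ShortTimeDecay.HasShortTimeDecay ((ε : ℂ) • A + C) a c →
        a = 2 * (m : ℝ) + 1 ∧ c = ShortTimeDecay.decayCoeff ε m μ := by
  classical
  obtain ⟨D, rfl⟩ := exists_eq_conjTranspose_mul_self hC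
  obtain ⟨ε₀, hε₀, hB⟩ := hHC
  have hε₀' : (ε₀ : ℂ) ≠ 0 := by exact_mod_cast hε₀
  have hex : ∃ k : ℕ, ∀ x, (∀ j < k, toOp D ((toOp A ^ j) x) = 0) → x = 0 := by
    obtain ⟨k, hk⟩ := exists_joint_kernel_trivial (re_inner_toOp_family (D := D) hA ε₀)
      (re_pos_of_isHypocoercive hB)
    exact ⟨k, fun x hx => hk x ((joint_kernel_iff hε₀' (toOp_family A D ε₀) k x).2 hx)⟩
  have : Nonempty (Fin n) := ⟨⟨0, hn⟩⟩
  -- The index is one less than the least number of observables `D A^j` that separate points; that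
  -- number is positive because the space is nonzero.
  obtain ⟨m, hm⟩ : ∃ m, Nat.find hex = m + 1 := by
    refine Nat.exists_eq_succ_of_ne_zero fun h0 => ?_
    have h := Nat.find_spec hex
    rw [h0] at h
    obtain ⟨v, hv⟩ := exists_ne (0 : EuclideanSpace ℂ (Fin n))
    exact hv (h v fun j hj => absurd hj (Nat.not_lt_zero j))
  have hspec := Nat.find_spec hex
  rw [hm] at hspec
  have hmin := Nat.find_min hex (show m < Nat.find hex by omega)
  push Not at hmin
  obtain ⟨x, hxker, hx0⟩ := hmin
  obtain ⟨x₀, hx₀, hker, hleast⟩ :=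
    exists_min_observable (toOp A) (toOp D) m hx0 hxker
  have hx₀0 : x₀ ≠ 0 := fun h => by simp [h] at hx₀
  -- Positivity of `μ`: otherwise `x₀` would lie in the trivial joint kernel of the first `m + 1`
  -- observables.
  have hne : toOp D ((toOp A ^ m) x₀) ≠ 0 := fun h0 => hx₀0 <| hspec x₀ fun j hj => by
    rcases Nat.lt_succ_iff_lt_or_eq.1 hj with h | rfl
    · exact hker j h
    · exact h0
  have hμ : 0 < ‖toOp D ((toOp A ^ m) x₀)‖ ^ 2 := by positivity
  refine ⟨m, ‖toOp D ((toOp A ^ m) x₀)‖ ^ 2, hμ, fun ε hε => ?_⟩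
  have hdecay := hasShortTimeDecay_family hA hε m hx₀ hker hleast
  refine ⟨hcIndex_family hA hε hspec hx₀0 hker, isLeast_kernelValues_family hA hε m hx₀ hker hleast,
    hdecay, fun a c _ hc h => h.unique hdecay hc.ne' ?_⟩
  rw [decayCoeff_eq]
  have := decayFactor_pos m
  positivity
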